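/- Fix $\gamma\in\mathbb R$. For $\Delta\xi>0$ and an integer $N\ge1$ put $R=N\Delta\xi$, $\xi_i=i\Delta\xi$. A discrete state $Y=(\zeta_i,U_i,H_i,v_i,w_i,h_i)_{i=-N}^{N-1}\in\mathbb R^{2N\times6}$, with $q_i=1+v_i$ and $y(\eta)=\zeta_j+\eta$ for $\eta\in[\xi_j,\xi_{j+1})$, has the norms $$\|Y\|_F=\|\zeta\|_\infty+\|U\|_2+\|U\|_\infty+\|H\|_\infty+\|v\|_2+\|w\|_2+\|h\|_2,\qquad \|Y\|_{F^\infty}=\|Y\|_F+\|q\|_\infty+\|w\|_\infty+\|h\|_\infty,$$ where $\|z\|_2=(\Delta\xi\sum_{i=-N}^{N-1} z_i^2)^{1/2}$ and $\|z\|_\infty=\max_i|z_i|$. Put $$P_i=\tfrac12\sum_{j=-N}^{N-1}\int_{\xi_j}^{\xi_{j+1}}e^{-\mathrm{sgn}(\xi_i-\eta)(y(\xi_i)-y(\eta))}\,d\eta\,\Bigl(\tfrac{3-2\gamma}2U_j^2q_j+\tfrac\gamma2h_j\Bigr),$$ $$Q_i=-\tfrac12\sum_{j=-N}^{N-1}\int_{\xi_j}^{\xi_{j+1}}\mathrm{sgn}(\xi_i-\eta)e^{-\mathrm{sgn}(\xi_i-\eta)(y(\xi_i)-y(\eta))}\,d\eta\,\Bigl(\tfrac{3-2\gamma}2U_j^2q_j+\tfrac\gamma2h_j\Bigr).$$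 The semi-discrete hyperelastic rod system $Y_t=G(Y)$ is $$\zeta_{i,t}=\gamma U_i,\quad U_{i,t}=-Q_i,\quad H_{i,t}=U_i^3-2P_iU_i,\quad v_{i,t}=\gamma w_i,$$ $$w_{i,t}=\tfrac\gamma2h_i+\bigl(\tfrac{3-2\gamma}2U_i^2-P_i\bigr)q_i,\quad h_{i,t}=-2Q_iU_iq_i+(3U_i^2-2P_i)w_i .$$ It is split as $G=G_1+G_2$, where $G_1$ has components $0,0,0,\ \gamma w_i,\ \frac\gamma2h_i+(\frac{3-2\gamma}2U_i^2-P_i)q_i,\ (3U_i^2-2P_i)w_i$ and $G_2$ has components $\gamma U_i,\ -Q_i,\ U_i^3-2P_iU_i,\ 0,\ 0,\ -2Q_iU_iq_i$. For $k=1,2$ let $\Phi^k_\tau$ be one step of size $\tau$, applied to $Y_t=G_k(Y)$, of a consistent Runge–Kutta method ($\sum_ib_i=1$) with $b_ia_{ij}+b_ja_{ji}=b_ib_j$ for all $i,j$ (for example the implicit midpoint rule). The implicit stage equations are solved near the current value: for a fixed $\rho>0$, all internal stages lie within $\|\cdot\|_F$-distance $\rho$ of the value from which the step starts. Let $\Phi_\tau=\Phi^2_\tau\circ\Phi^1_\tau$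 (Lie–Trotter) or $\Phi_\tau=\Phi^1_{\tau/2}\circ\Phi^2_\tau\circ\Phi^1_{\tau/2}$ (Strang). **Theorem.** Let $\gamma$, the two Runge–Kutta methods, the type of splitting and $\rho>0$ be fixed as above. Let $c>0$, $T>0$, $M_0$ and $M$ be given. There is $n>0$, depending only on these data, such that the following holds for all $\Delta\xi>0$, $N\ge1$, $N_T\ge1$ with $\Delta\xi+\frac1R+\Delta t<\frac1n$, where $R=N\Delta\xi$ and $\Delta t=T/N_T$. Let $Y^0$ be a discrete state with $\|Y^0\|_{F^\infty}\le M_0$ and $$q_i^0h_i^0\ge(U_i^0q_i^0)^2+(w_i^0)^2,\quad q_i^0\ge0,\quad h_i^0\ge0,\quad q_i^0+h_i^0\ge c\qquad(i=-N,\dots,N-1),$$ for which the semi-discrete system has a solution $\phi$ on $[0,T]$ with $\phi(0)=Y^0$ and $\sup_{t\in[0,T]}\|\phi(t)\|_F\le M$. Then the scheme is well defined, that is, there is exactly one sequence $Y^0,\dots,Y^{N_T}$ with $Y^{j+1}=\Phi_{\Delta t}(Y^j)$, and it preserves the positivity of the particle density $1/q$ and of the energy density $h$: $$q_i^j\ge0\quad\text{and}\quad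 h_i^j\ge0\qquad\text{for } i=-N,\dots,N-1,\ j=1,\dots,N_T .$$ -/

import Mathlib

namespace HyperelasticRod

/-- The indices `i = -N, …, N - 1` of the grid cells `[ξ_i, ξ_{i+1})`. -/
abbrev Cell (N : ℕ) : Type := ↥(Finset.Ico (-(N : ℤ)) (N : ℤ))

/-- The space `ℝ^{2N × 6}` of discrete states; the six components are `ζ, U, H, v, w, h`, where
`y_i = ζ_i + ξ_i` and `q_i = 1 + v_i`. -/
abbrev State (N : ℕ) : Type := Fin 6 → Cell N → ℝ

namespace State

variable {N : ℕ}

def zeta (Y : State N) : Cell N → ℝ := Y 0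
def U (Y : State N) : Cell N → ℝ := Y 1
def H (Y : State N) : Cell N → ℝ := Y 2
def v (Y : State N) : Cell N → ℝ := Y 3
def w (Y : State N) : Cell N → ℝ := Y 4
def h (Y : State N) : Cell N → ℝ := Y 5

def q (Y : State N) : Cell N → ℝ := fun i => 1 + Y.v i

end State

/-- The grid points `ξ_i = i Δξ`. -/
def gridPt {N : ℕ} (dx : ℝ) (i : Cell N) : ℝ := ((i : ℤ) : ℝ) * dx

/-- The discrete norm `(Δξ ∑ z_i²)^{1/2}`. -/
noncomputable def l2Norm {N : ℕ} (dx : ℝ) (z : Cell N → ℝ) : ℝ :=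
  Real.sqrt (dx * ∑ i, z i ^ 2)

/-- The norm of `F` on discrete states (`‖z‖` is the maximum norm on `Cell N → ℝ`). -/
noncomputable def normF {N : ℕ} (dx : ℝ) (Y : State N) : ℝ :=
  ‖Y.zeta‖ + l2Norm dx Y.U + ‖Y.U‖ + ‖Y.H‖ + l2Norm dx Y.v + l2Norm dx Y.w + l2Norm dx Y.h

/-- The quantity `‖Y‖_{F^∞} = ‖Y‖_F + ‖q‖_∞ + ‖w‖_∞ + ‖h‖_∞`. -/
noncomputable def normFInf {N : ℕ} (dx : ℝ) (Y : State N) : ℝ :=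
  normF dx Y + ‖Y.q‖ + ‖Y.w‖ + ‖Y.h‖

/-- The density `(3 - 2γ)/2 U² q + γ/2 h` on the `j`-th cell. -/
noncomputable def source {N : ℕ} (γ : ℝ) (Y : State N) (j : Cell N) : ℝ :=
  (3 - 2 * γ) / 2 * Y.U j ^ 2 * Y.q j + γ / 2 * Y.h j

/-- The kernel `exp(-sgn(ξ_i - η) (y(ξ_i) - y(η)))` for `η` in the `j`-th cell, where
`y(η) = ζ_j + η`. -/
noncomputable def kernel {N : ℕ} (dx : ℝ) (Y : State N) (i j : Cell N) (η : ℝ) : ℝ :=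
  Real.exp (-(Real.sign (gridPt dx i - η)) *
    ((Y.zeta i + gridPt dx i) - (Y.zeta j + η)))

/-- `P_i = 1/2 ∫ exp(-sgn(ξ_i - η)(y(ξ_i) - y(η))) ((3 - 2γ)/2 U² q + γ/2 h)(η) dη` for the
piecewise constant functions with values `Y` (and `U = h = 0` outside the grid): the integral over
the real line is the sum of the integrals over the cells. -/
noncomputable def P {N : ℕ} (γ dx : ℝ) (Y : State N) (i : Cell N) : ℝ :=
  1 / 2 * ∑ j : Cell N,
    ∫ η in (gridPt dx j)..(gridPt dx j + dx), kernel dx Y i j η * source γ Y j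

/-- `Q_i = -1/2 ∫ sgn(ξ_i - η) exp(-sgn(ξ_i - η)(y(ξ_i) - y(η))) ((3 - 2γ)/2 U² q + γ/2 h)(η) dη`,
split into cells as for `P`. -/
noncomputable def Q {N : ℕ} (γ dx : ℝ) (Y : State N) (i : Cell N) : ℝ :=
  -(1 / 2) * ∑ j : Cell N,
    ∫ η in (gridPt dx j)..(gridPt dx j + dx),
      Real.sign (gridPt dx i - η) * kernel dx Y i j η * source γ Y j

/-- The right-hand side of the space-discretised system. -/
noncomputable def fieldG {N : ℕ} (γ dx : ℝ) (Y : State N) : State N :=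
  ![fun i => γ * Y.U i,
    fun i => -Q γ dx Y i,
    fun i => Y.U i ^ 3 - 2 * P γ dx Y i * Y.U i,
    fun i => γ * Y.w i,
    fun i => γ / 2 * Y.h i + ((3 - 2 * γ) / 2 * Y.U i ^ 2 - P γ dx Y i) * Y.q i,
    fun i => -2 * Q γ dx Y i * Y.U i * Y.q i + (3 * Y.U i ^ 2 - 2 * P γ dx Y i) * Y.w i]

/-- The right-hand side of the first subsystem (`ζ, U, H` frozen). -/
noncomputable def fieldG₁ {N : ℕ} (γ dx : ℝ) (Y : State N) : State N :=
  ![0, 0, 0,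
    fun i => γ * Y.w i,
    fun i => γ / 2 * Y.h i + ((3 - 2 * γ) / 2 * Y.U i ^ 2 - P γ dx Y i) * Y.q i,
    fun i => (3 * Y.U i ^ 2 - 2 * P γ dx Y i) * Y.w i]

/-- The right-hand side of the second subsystem (`q, w` frozen). -/
noncomputable def fieldG₂ {N : ℕ} (γ dx : ℝ) (Y : State N) : State N :=
  ![fun i => γ * Y.U i,
    fun i => -Q γ dx Y i,
    fun i => Y.U i ^ 3 - 2 * P γ dx Y i * Y.U i,
    0, 0,
    fun i => -2 * Q γ dx Y i * Y.U i * Y.q i]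

/-- `φ` solves the space-discretised system on `[0, T]` with initial value `Y₀`. -/
def IsSemidiscreteSolution {N : ℕ} (γ dx T : ℝ) (Y₀ : State N) (φ : ℝ → State N) : Prop :=
  φ 0 = Y₀ ∧
    ∀ t ∈ Set.Icc (0 : ℝ) T, HasDerivWithinAt φ (fieldG γ dx (φ t)) (Set.Icc 0 T) t

/-- The coefficients of an `s`-stage Runge–Kutta method. -/
structure RungeKutta (s : ℕ) where
  a : Fin s → Fin s → ℝ
  b : Fin s → ℝ

namespace RungeKutta

variable {s : ℕ}

/-- Consistency (order at least one). -/
def Consistent (rk : RungeKutta s) : Prop := ∑ i, rk.b i = 1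

/-- The condition under which the method preserves quadratic invariants. -/
def PreservesQuadratic (rk : RungeKutta s) : Prop :=
  ∀ i j, rk.b i * rk.a i j + rk.b j * rk.a j i = rk.b i * rk.b j

/-- `Z` is obtained from `Y` by one step of size `τ` of the method for `Y_t = X(Y)`, where the
(in general implicit) stage equations are solved with all internal stages
`Y + τ ∑ a_ij K_j` at distance at most `ρ` from `Y`. -/
def IsStep (rk : RungeKutta s) {N : ℕ} (dx ρ : ℝ) (X : State N → State N) (τ : ℝ)
    (Y Z : State N) : Prop :=
  ∃ K : Fin s → State N,
    (∀ i, K i = X (Y + τ • ∑ j, rk.a i j • K j)) ∧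
    (∀ i, normF dx (τ • ∑ j, rk.a i j • K j) ≤ ρ) ∧
    Z = Y + τ • ∑ i, rk.b i • K i

end RungeKutta

inductive Splitting where
  | lieTrotter
  | strang

/-- One step of the splitting scheme: `Φ²_τ ∘ Φ¹_τ` (Lie–Trotter) or
`Φ¹_{τ/2} ∘ Φ²_τ ∘ Φ¹_{τ/2}` (Strang). -/
def IsSplittingStep {s₁ s₂ N : ℕ} (S : Splitting) (rk₁ : RungeKutta s₁) (rk₂ : RungeKutta s₂)
    (γ dx ρ τ : ℝ) (Y Z : State N) : Prop :=
  match S with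
  | .lieTrotter => ∃ A : State N,
      rk₁.IsStep dx ρ (fieldG₁ γ dx) τ Y A ∧ rk₂.IsStep dx ρ (fieldG₂ γ dx) τ A Z
  | .strang => ∃ A B : State N,
      rk₁.IsStep dx ρ (fieldG₁ γ dx) (τ / 2) Y A ∧ rk₂.IsStep dx ρ (fieldG₂ γ dx) τ A B ∧
        rk₁.IsStep dx ρ (fieldG₁ γ dx) (τ / 2) B Z

/-- `Y j`, `j = 0, …, NT`, is a sequence produced by the fully discrete scheme with time step `τ`
and initial value `Y₀`. -/
def IsNumericalSolution {s₁ s₂ N : ℕ} (S : Splitting) (rk₁ : RungeKutta s₁)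
    (rk₂ : RungeKutta s₂) (γ dx ρ τ : ℝ) (NT : ℕ) (Y₀ : State N) (Y : ℕ → State N) : Prop :=
  Y 0 = Y₀ ∧ ∀ j < NT, IsSplittingStep S rk₁ rk₂ γ dx ρ τ (Y j) (Y (j + 1))

end HyperelasticRod

/-! Positivity comes from an algebraic invariant, well-posedness from convergence of a first-order
one-step method; every constant is independent of the grid.

Invariant. In each cell consider the gap `q h - (U q)² - w²`. For `G₁` the variable `U` is frozen,
so the gap is a quadratic form in `(q, w, h)`; for `G₂` the variables `q, w` are frozen, so it is
quadratic in `U` and linear in `h`. Both flows conserve it, whatever the values of `P` and `Q`, and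
so do Runge–Kutta methods with `b_i a_ij + b_j a_ji = b_i b_j` (`energyGap_step₁`,
`energyGap_step₂`). A nonnegative gap forces `q h ≥ 0`, so `q` and `h` have the same sign, and `q +
h > 0` excludes the negative one. The sum stays positive because it bounds `q`, `|w|` and `h`, while
the `(v, w, h)` components of the fields are bounded linearly by `(q, w, h)`: for small steps the
loss of `q + h` in a substep is a fraction below one of `q + h` itself (`Admissible.step`). No lower
bound has to survive the accumulation of steps.

Well-posedness. On balls of the `F` norm, `G₁` and `G₂` are bounded and Lipschitz uniformly in the
grid (`fieldG₁_bound`, `fieldG₂_bound`). The nonlocal terms are the only difficulty: each cell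
integral is explicit, the weights have row and column sums at most 2, and Schur's test applies.
Hence the stage equations are uniquely solvable by contraction, a splitting step agrees with an
Euler step for `G` up to `O(Δt²)` (`stepEstimate_splitting`), and a discrete Gronwall argument keeps
the numerical solution within distance 1 of `φ` (`norm_sub_le_one_of_step`). It therefore never
leaves the ball where the next step exists (`StepEstimate.exists_unique_sequence`). -/

namespace HyperelasticRod

/-! ### Runge–Kutta steps in a normed space -/

section Abstract

variable {E : Type*} [NormedAddCommGroup E] [NormedSpace ℝ E]

namespace RungeKutta

variable {s : ℕ}

/-- The sum of the absolute values of the coefficients `a_ij`. -/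
noncomputable def absA (rk : RungeKutta s) : ℝ := ∑ i, ∑ j, |rk.a i j|

/-- The sum of the absolute values of the weights `b_i`. -/
noncomputable def absB (rk : RungeKutta s) : ℝ := ∑ i, |rk.b i|

lemma absA_nonneg (rk : RungeKutta s) : 0 ≤ rk.absA :=
  Finset.sum_nonneg fun _ _ => Finset.sum_nonneg fun _ _ => abs_nonneg _

lemma absB_nonneg (rk : RungeKutta s) : 0 ≤ rk.absB :=
  Finset.sum_nonneg fun _ _ => abs_nonneg _

lemma norm_stage_le (rk : RungeKutta s) {τ C : ℝ} (hτ : 0 ≤ τ) (hC : 0 ≤ C) {K : Fin s → E}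
    (hK : ∀ i, ‖K i‖ ≤ C) (i : Fin s) : ‖τ • ∑ j, rk.a i j • K j‖ ≤ τ * (rk.absA * C) := by
  rw [norm_smul, Real.norm_of_nonneg hτ]
  refine mul_le_mul_of_nonneg_left ?_ hτ
  calc ‖∑ j, rk.a i j • K j‖ ≤ ∑ j, |rk.a i j| * C := by
        refine (norm_sum_le _ _).trans (Finset.sum_le_sum fun j _ => ?_)
        rw [norm_smul, Real.norm_eq_abs]
        exact mul_le_mul_of_nonneg_left (hK j) (abs_nonneg _)
    _ = (∑ j, |rk.a i j|) * C := by rw [Finset.sum_mul]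
    _ ≤ rk.absA * C := by
        refine mul_le_mul_of_nonneg_right ?_ hC
        exact Finset.single_le_sum (f := fun i => ∑ j, |rk.a i j|)
          (fun _ _ => Finset.sum_nonneg fun _ _ => abs_nonneg _) (Finset.mem_univ i)

lemma norm_weighted_le (rk : RungeKutta s) {C : ℝ} {K : Fin s → E}
    (hK : ∀ i, ‖K i‖ ≤ C) : ‖∑ i, rk.b i • K i‖ ≤ rk.absB * C := by
  rw [absB, Finset.sum_mul]
  refine (norm_sum_le _ _).trans (Finset.sum_le_sum fun j _ => ?_)
  rw [norm_smul, Real.norm_eq_abs]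
  exact mul_le_mul_of_nonneg_left (hK j) (abs_nonneg _)

/-- One Runge–Kutta step in a normed space, with all stages at distance at most `ρ`. -/
def NormStep (rk : RungeKutta s) (ρ : ℝ) (X : E → E) (τ : ℝ) (Y Z : E) : Prop :=
  ∃ K : Fin s → E,
    (∀ i, K i = X (Y + τ • ∑ j, rk.a i j • K j)) ∧
    (∀ i, ‖τ • ∑ j, rk.a i j • K j‖ ≤ ρ) ∧
    Z = Y + τ • ∑ i, rk.b i • K i

variable {rk : RungeKutta s} {ρ r B L τ : ℝ} {X : E → E} {Y Z : E}

lemma norm_add_stage_le {F : Type*} [NormedAddCommGroup F] {Y : F} (hY : ‖Y‖ + ρ ≤ r)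
    {x : F} (hx : ‖x‖ ≤ ρ) : ‖Y + x‖ ≤ r :=
  (norm_add_le _ _).trans (by linarith)

lemma NormStep.norm_sub_le (hτ : 0 ≤ τ) (hXB : ∀ x, ‖x‖ ≤ r → ‖X x‖ ≤ B) (hY : ‖Y‖ + ρ ≤ r)
    (h : rk.NormStep ρ X τ Y Z) : ‖Z - Y‖ ≤ τ * (rk.absB * B) := by
  obtain ⟨K, hK, hKρ, rfl⟩ := h
  rw [add_sub_cancel_left, norm_smul, Real.norm_of_nonneg hτ]
  refine mul_le_mul_of_nonneg_left (rk.norm_weighted_le fun i => ?_) hτ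
  rw [hK i]
  exact hXB _ (norm_add_stage_le hY (hKρ i))

/-- Since the weights sum to one, the deviation from an Euler step is the weighted sum of the `K i -
X Y`, and each of these is `O(τ)` by the Lipschitz bound. -/
lemma NormStep.norm_sub_sub_le (hcons : rk.Consistent) (hτ : 0 ≤ τ) (hB : 0 ≤ B) (hL : 0 ≤ L)
    (hρ : 0 ≤ ρ) (hXB : ∀ x, ‖x‖ ≤ r → ‖X x‖ ≤ B)
    (hXL : ∀ x y, ‖x‖ ≤ r → ‖y‖ ≤ r → ‖X x - X y‖ ≤ L * ‖x - y‖) (hY : ‖Y‖ + ρ ≤ r)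
    (h : rk.NormStep ρ X τ Y Z) :
    ‖Z - Y - τ • X Y‖ ≤ rk.absB * L * rk.absA * B * τ ^ 2 := by
  obtain ⟨K, hK, hKρ, rfl⟩ := h
  have hKB : ∀ i, ‖K i‖ ≤ B := fun i => by
    rw [hK i]
    exact hXB _ (norm_add_stage_le hY (hKρ i))
  have e : Y + τ • ∑ i, rk.b i • K i - Y - τ • X Y = τ • ∑ i, rk.b i • (K i - X Y) := by
    have hc : ∑ i, rk.b i = 1 := hcons
    simp only [smul_sub, Finset.sum_sub_distrib, ← Finset.sum_smul, hc, one_smul]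
    abel
  have hd : ∀ i, ‖K i - X Y‖ ≤ L * (τ * (rk.absA * B)) := fun i => by
    rw [hK i]
    refine (hXL _ _ (norm_add_stage_le hY (hKρ i)) (by linarith)).trans ?_
    rw [add_sub_cancel_left]
    exact mul_le_mul_of_nonneg_left (rk.norm_stage_le hτ hB hKB i) hL
  rw [e, norm_smul, Real.norm_of_nonneg hτ]
  calc τ * ‖∑ i, rk.b i • (K i - X Y)‖ ≤ τ * (rk.absB * (L * (τ * (rk.absA * B)))) :=
        mul_le_mul_of_nonneg_left (rk.norm_weighted_le hd) hτ
    _ = _ := by ring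

lemma norm_stage_sub_le (hτ : 0 ≤ τ) (hL : 0 ≤ L)
    (hXL : ∀ x y, ‖x‖ ≤ r → ‖y‖ ≤ r → ‖X x - X y‖ ≤ L * ‖x - y‖) (hY : ‖Y‖ + ρ ≤ r)
    {K K' : Fin s → E} (hK : ∀ i, ‖τ • ∑ j, rk.a i j • K j‖ ≤ ρ)
    (hK' : ∀ i, ‖τ • ∑ j, rk.a i j • K' j‖ ≤ ρ) (i : Fin s) :
    ‖X (Y + τ • ∑ j, rk.a i j • K j) - X (Y + τ • ∑ j, rk.a i j • K' j)‖ ≤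
      L * rk.absA * τ * ‖K - K'‖ := by
  refine (hXL _ _ (norm_add_stage_le hY (hK i)) (norm_add_stage_le hY (hK' i))).trans ?_
  have e : Y + τ • ∑ j, rk.a i j • K j - (Y + τ • ∑ j, rk.a i j • K' j) =
      τ • ∑ j, rk.a i j • (K - K') j := by
    simp only [Pi.sub_apply, smul_sub, Finset.sum_sub_distrib]
    abel
  rw [e]
  calc _ ≤ L * (τ * (rk.absA * ‖K - K'‖)) :=
        mul_le_mul_of_nonneg_left
          (rk.norm_stage_le hτ (norm_nonneg _) (fun j => norm_le_pi_norm (K - K') j) i) hL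
    _ = _ := by ring

/-- Two slope tuples with stages near `Y` are at most half their own distance apart, hence equal. -/
lemma NormStep.unique (hτ : 0 ≤ τ) (hL : 0 ≤ L)
    (hXL : ∀ x y, ‖x‖ ≤ r → ‖y‖ ≤ r → ‖X x - X y‖ ≤ L * ‖x - y‖) (hY : ‖Y‖ + ρ ≤ r)
    (hsmall : L * rk.absA * τ ≤ 1 / 2) {Z' : E}
    (h : rk.NormStep ρ X τ Y Z) (h' : rk.NormStep ρ X τ Y Z') : Z = Z' := by
  obtain ⟨K, hK, hKρ, rfl⟩ := h
  obtain ⟨K', hK', hKρ', rfl⟩ := h'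
  have hle : ‖K - K'‖ ≤ 1 / 2 * ‖K - K'‖ := by
    refine (pi_norm_le_iff_of_nonneg (by positivity)).2 fun i => ?_
    rw [Pi.sub_apply, hK i, hK' i]
    exact (norm_stage_sub_le hτ hL hXL hY hKρ hKρ' i).trans
      (mul_le_mul_of_nonneg_right hsmall (norm_nonneg _))
  have h0 : K = K' := sub_eq_zero.1 (norm_le_zero_iff.1 (by linarith [norm_nonneg (K - K')]))
  rw [h0]

/-- Banach's fixed point theorem for the slopes on the ball of radius `B`; `hsmall'` makes slopes in
that ball produce stages within `ρ`. -/
lemma NormStep.exists [CompleteSpace E] (hτ : 0 ≤ τ) (hB : 0 ≤ B) (hL : 0 ≤ L)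
    (hXB : ∀ x, ‖x‖ ≤ r → ‖X x‖ ≤ B)
    (hXL : ∀ x y, ‖x‖ ≤ r → ‖y‖ ≤ r → ‖X x - X y‖ ≤ L * ‖x - y‖) (hY : ‖Y‖ + ρ ≤ r)
    (hsmall : L * rk.absA * τ ≤ 1 / 2) (hsmall' : rk.absA * B * τ ≤ ρ) :
    ∃ Z, rk.NormStep ρ X τ Y Z := by
  let F : (Fin s → E) → Fin s → E := fun K i => X (Y + τ • ∑ j, rk.a i j • K j)
  let S : Set (Fin s → E) := Metric.closedBall 0 B
  have hS : ∀ K ∈ S, ∀ i, ‖τ • ∑ j, rk.a i j • K j‖ ≤ ρ := fun K hK i => by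
    refine (rk.norm_stage_le hτ hB (fun j => ?_) i).trans (by linarith)
    exact (norm_le_pi_norm K j).trans (mem_closedBall_zero_iff.1 hK)
  have hmaps : Set.MapsTo F S S := fun K hK =>
    mem_closedBall_zero_iff.2 ((pi_norm_le_iff_of_nonneg hB).2 fun i =>
      hXB _ (norm_add_stage_le hY (hS K hK i)))
  have hcontr : ContractingWith (1 / 2) (hmaps.restrict F S S) := by
    refine ⟨by rw [← NNReal.coe_lt_coe]; norm_num, LipschitzWith.of_dist_le_mul fun K K' => ?_⟩
    rw [Subtype.dist_eq, Subtype.dist_eq, dist_eq_norm, dist_eq_norm]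
    refine (pi_norm_le_iff_of_nonneg (by positivity)).2 fun i => ?_
    refine (norm_stage_sub_le hτ hL hXL hY (hS K K.2) (hS K' K'.2) i).trans ?_
    refine (mul_le_mul_of_nonneg_right hsmall (norm_nonneg _)).trans (le_of_eq ?_)
    norm_num
  obtain ⟨K, hKS, hK, -⟩ := hcontr.exists_fixedPoint' Metric.isClosed_closedBall.isComplete hmaps
    (x := 0) (Metric.mem_closedBall_self hB) (edist_ne_top _ _)
  exact ⟨_, K, fun i => (congrFun hK i).symm, hS K hKS, rfl⟩

/-- If the slopes are bounded linearly by the stages, then so is the increment. -/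
lemma norm_increment_le {C : ℝ} (hτ : 0 ≤ τ) (hC : 0 ≤ C) {K : Fin s → E}
    (hK : ∀ i, ‖K i‖ ≤ C * ‖Y + τ • ∑ j, rk.a i j • K j‖) (hsmall : C * rk.absA * τ ≤ 1 / 2) :
    ‖τ • ∑ i, rk.b i • K i‖ ≤ 2 * C * rk.absB * τ * ‖Y‖ := by
  -- The slopes occur on both sides; smallness of `τ` lets half of `‖K‖` be absorbed.
  have h1 : ‖K‖ ≤ C * ‖Y‖ + 1 / 2 * ‖K‖ := by
    refine (pi_norm_le_iff_of_nonneg (by positivity)).2 fun i => (hK i).trans ?_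
    calc C * ‖Y + τ • ∑ j, rk.a i j • K j‖ ≤ C * (‖Y‖ + τ * (rk.absA * ‖K‖)) :=
          mul_le_mul_of_nonneg_left ((norm_add_le _ _).trans (add_le_add_right
            (rk.norm_stage_le hτ (norm_nonneg _) (norm_le_pi_norm K) i) _)) hC
      _ = C * ‖Y‖ + C * rk.absA * τ * ‖K‖ := by ring
      _ ≤ _ := by gcongr
  have h2 : ‖K‖ ≤ 2 * C * ‖Y‖ := by linarith
  rw [norm_smul, Real.norm_of_nonneg hτ]
  calc τ * ‖∑ i, rk.b i • K i‖ ≤ τ * (rk.absB * (2 * C * ‖Y‖)) :=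
        mul_le_mul_of_nonneg_left
          (rk.norm_weighted_le fun i => (norm_le_pi_norm K i).trans h2) hτ
    _ = _ := by ring

/-- The product rule for methods preserving quadratic invariants. -/
lemma PreservesQuadratic.mul_sub_mul (hq : rk.PreservesQuadratic) (x y : ℝ) (k l : Fin s → ℝ) :
    (x + τ * ∑ i, rk.b i * k i) * (y + τ * ∑ i, rk.b i * l i) - x * y =
      τ * ∑ i, rk.b i * ((x + τ * ∑ j, rk.a i j * k j) * l i +
        (y + τ * ∑ j, rk.a i j * l j) * k i) := by
  have h1 : (∑ i, rk.b i * k i) * (∑ i, rk.b i * l i) =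
      ∑ i, ∑ j, rk.b i * rk.a i j * (k j * l i) + ∑ i, ∑ j, rk.b i * rk.a i j * (l j * k i) := by
    rw [Finset.sum_mul_sum, Finset.sum_comm (f := fun i j => rk.b i * rk.a i j * (k j * l i)),
      ← Finset.sum_add_distrib]
    refine Finset.sum_congr rfl fun i _ => ?_
    rw [← Finset.sum_add_distrib]
    refine Finset.sum_congr rfl fun j _ => ?_
    -- The condition on the coefficients enters here, pairwise in `(i, j)`, to match the `τ²` terms.
    linear_combination (-(k i * l j)) * hq i j
  have h2 : ∑ i, rk.b i * ((x + τ * ∑ j, rk.a i j * k j) * l i +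
        (y + τ * ∑ j, rk.a i j * l j) * k i) = x * ∑ i, rk.b i * l i + y * ∑ i, rk.b i * k i +
      τ * (∑ i, ∑ j, rk.b i * rk.a i j * (k j * l i) +
        ∑ i, ∑ j, rk.b i * rk.a i j * (l j * k i)) := by
    simp only [Finset.mul_sum, ← Finset.sum_add_distrib]
    refine Finset.sum_congr rfl fun i _ => ?_
    have e1 : ∀ m : Fin s → ℝ, ∀ p : ℝ, ∑ j, τ * (rk.b i * rk.a i j * (m j * p)) =
        rk.b i * p * ∑ j, τ * (rk.a i j * m j) := fun m p => by
      rw [Finset.mul_sum]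
      exact Finset.sum_congr rfl fun j _ => by ring
    simp only [mul_add τ, Finset.sum_add_distrib, e1]
    ring
  rw [h2, ← h1]
  ring

end RungeKutta

/-! ### Convergence along a bounded trajectory -/

/-- Convergence of a one-step method of order one along a bounded trajectory: any sequence
produced by the method stays at distance at most `1`. -/
lemma norm_sub_le_one_of_step {X : E → E} {Step : E → E → Prop} {φ : ℝ → E} {r B L D T τ : ℝ}
    (hτ : 0 ≤ τ) (hB : 0 ≤ B) (hL : 0 ≤ L) (hD : 0 ≤ D)
    (hXB : ∀ x, ‖x‖ ≤ r + 1 → ‖X x‖ ≤ B)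
    (hXL : ∀ x y, ‖x‖ ≤ r + 1 → ‖y‖ ≤ r + 1 → ‖X x - X y‖ ≤ L * ‖x - y‖)
    (hφ : ∀ t ∈ Set.Icc (0 : ℝ) T, HasDerivWithinAt φ (X (φ t)) (Set.Icc 0 T) t)
    (hφr : ∀ t ∈ Set.Icc (0 : ℝ) T, ‖φ t‖ ≤ r)
    (hstep : ∀ Y Z, ‖Y‖ ≤ r + 1 → Step Y Z → ‖Z - Y - τ • X Y‖ ≤ D * τ ^ 2)
    (hsmall : (D + L * B) * T * Real.exp (L * T) * τ ≤ 1)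
    {J : ℕ} (hJ : J * τ ≤ T) {Y : ℕ → E} (h0 : Y 0 = φ 0) (hY : ∀ j < J, Step (Y j) (Y (j + 1))) :
    ∀ j ≤ J, ‖Y j - φ (j * τ)‖ ≤ 1 := by
  have hT : 0 ≤ T := le_trans (by positivity) hJ
  have hlip : ∀ t ∈ Set.Icc (0 : ℝ) T, ∀ t' ∈ Set.Icc (0 : ℝ) T, ‖φ t' - φ t‖ ≤ B * ‖t' - t‖ :=
    fun t ht t' ht' => (convex_Icc 0 T).norm_image_sub_le_of_norm_hasDerivWithin_le hφ
      (fun x hx => hXB _ ((hφr x hx).trans (by linarith))) ht ht'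
  -- Local error of Euler along the exact solution: `φ` is `B`-Lipschitz, so the derivative of `φ u
  -- - u • X (φ t)` is at most `L B τ` on the step.
  have hexact : ∀ t, 0 ≤ t → t + τ ≤ T → ‖φ (t + τ) - φ t - τ • X (φ t)‖ ≤ L * B * τ ^ 2 := by
    intro t ht htT
    have hsub : Set.Icc t (t + τ) ⊆ Set.Icc 0 T := Set.Icc_subset_Icc ht htT
    have hder : ∀ u ∈ Set.Icc t (t + τ), HasDerivWithinAt (fun u => φ u - u • X (φ t))
        (X (φ u) - X (φ t)) (Set.Icc t (t + τ)) u := fun u hu => by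
      have := ((hφ u (hsub hu)).mono hsub).sub
        ((hasDerivWithinAt_id u (Set.Icc t (t + τ))).smul_const (X (φ t)))
      rwa [one_smul] at this
    have htm : t ∈ Set.Icc t (t + τ) := ⟨le_rfl, by linarith⟩
    have := (convex_Icc t (t + τ)).norm_image_sub_le_of_norm_hasDerivWithin_le
      (C := L * (B * τ)) hder (fun u hu => by
        refine (hXL _ _ ((hφr u (hsub hu)).trans (by linarith))
          ((hφr t (hsub htm)).trans (by linarith))).trans (mul_le_mul_of_nonneg_left ?_ hL)
        refine (hlip t (hsub htm) u (hsub hu)).trans (mul_le_mul_of_nonneg_left ?_ hB)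
        rw [Real.norm_of_nonneg (by linarith [hu.1])]
        linarith [hu.2]) htm ⟨by linarith, le_rfl⟩
    rw [add_sub_cancel_left, Real.norm_of_nonneg hτ] at this
    calc _ = ‖φ (t + τ) - (t + τ) • X (φ t) - (φ t - t • X (φ t))‖ := by
          rw [add_smul]; congr 1; abel
      _ ≤ _ := this
      _ = _ := by ring
  -- Discrete Gronwall, by induction: the bound at step `j`, together with `hsmall`, shows that `Y
  -- j` is still in the ball where the estimates for `X` hold.
  have key : ∀ j ≤ J, ‖Y j - φ (j * τ)‖ ≤ (D + L * B) * τ ^ 2 * j * Real.exp (L * τ * j) := by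
    intro j
    induction j with
    | zero => intro _; simp [h0]
    | succ j ih =>
      intro hj
      have hjT : (j : ℝ) * τ + τ ≤ T := by
        have : ((j + 1 : ℕ) : ℝ) ≤ J := by exact_mod_cast hj
        push_cast at this
        nlinarith
      have hj0 : 0 ≤ (j : ℝ) * τ := by positivity
      have ihj := ih (by omega)
      have hmem : (j : ℝ) * τ ∈ Set.Icc 0 T := ⟨hj0, by linarith⟩
      have hone : ‖Y j - φ (j * τ)‖ ≤ 1 := by
        refine ihj.trans (le_trans ?_ hsmall)
        have h1 : Real.exp (L * τ * j) ≤ Real.exp (L * T) := Real.exp_le_exp.2 (by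
          rw [mul_assoc, mul_comm τ]; exact mul_le_mul_of_nonneg_left hmem.2 hL)
        calc (D + L * B) * τ ^ 2 * j * Real.exp (L * τ * j)
            = (D + L * B) * τ * (j * τ) * Real.exp (L * τ * j) := by ring
          _ ≤ (D + L * B) * τ * T * Real.exp (L * T) := by
            have := hmem.2
            gcongr
          _ = _ := by ring
      have hYr : ‖Y j‖ ≤ r + 1 := by
        have := norm_add_le (Y j - φ (j * τ)) (φ (j * τ))
        rw [sub_add_cancel] at this
        linarith [hφr _ hmem]
      have h1 := hstep _ _ hYr (hY j (by omega))
      have h2 := hexact _ hj0 hjT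
      have h3 := hXL _ _ hYr ((hφr _ hmem).trans (by linarith))
      have e : Y (j + 1) - φ (((j + 1 : ℕ) : ℝ) * τ) =
          (Y (j + 1) - Y j - τ • X (Y j)) - (φ (j * τ + τ) - φ (j * τ) - τ • X (φ (j * τ)))
          + ((Y j - φ (j * τ)) + τ • (X (Y j) - X (φ (j * τ)))) := by
        rw [smul_sub]
        push_cast
        rw [add_mul, one_mul]
        abel
      have h4 : ‖τ • (X (Y j) - X (φ (j * τ)))‖ ≤ τ * (L * ‖Y j - φ (j * τ)‖) := by
        rw [norm_smul, Real.norm_of_nonneg hτ]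
        exact mul_le_mul_of_nonneg_left h3 hτ
      have h5 : ‖Y (j + 1) - φ (((j + 1 : ℕ) : ℝ) * τ)‖ ≤
          (D + L * B) * τ ^ 2 + (1 + L * τ) * ‖Y j - φ (j * τ)‖ := by
        rw [e]
        refine (norm_add_le _ _).trans ?_
        have := norm_sub_le (Y (j + 1) - Y j - τ • X (Y j))
          (φ (j * τ + τ) - φ (j * τ) - τ • X (φ (j * τ)))
        have := norm_add_le (Y j - φ (j * τ)) (τ • (X (Y j) - X (φ (j * τ))))
        nlinarith
      have h6 : 1 + L * τ ≤ Real.exp (L * τ) := by linarith [Real.add_one_le_exp (L * τ)]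
      have h7 : Real.exp (L * τ * ((j + 1 : ℕ) : ℝ)) =
          Real.exp (L * τ) * Real.exp (L * τ * j) := by
        rw [← Real.exp_add]; push_cast; ring_nf
      have h8 : 1 ≤ Real.exp (L * τ * ((j + 1 : ℕ) : ℝ)) := Real.one_le_exp (by positivity)
      calc _ ≤ _ := h5
        _ ≤ (D + L * B) * τ ^ 2 * Real.exp (L * τ * ((j + 1 : ℕ) : ℝ)) + Real.exp (L * τ) *
            ((D + L * B) * τ ^ 2 * j * Real.exp (L * τ * j)) := by
          refine add_le_add (le_mul_of_one_le_right (by positivity) h8) ?_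
          exact mul_le_mul h6 ihj (norm_nonneg _) (Real.exp_pos _).le
        _ = _ := by rw [h7]; push_cast; ring
  intro j hj
  have hjT : (j : ℝ) * τ ≤ T :=
    le_trans (mul_le_mul_of_nonneg_right (by exact_mod_cast hj) hτ) hJ
  refine (key j hj).trans (le_trans ?_ hsmall)
  have h1 : Real.exp (L * τ * j) ≤ Real.exp (L * T) := Real.exp_le_exp.2 (by
    rw [mul_assoc, mul_comm τ]; exact mul_le_mul_of_nonneg_left hjT hL)
  calc (D + L * B) * τ ^ 2 * j * Real.exp (L * τ * j)
      = (D + L * B) * τ * (j * τ) * Real.exp (L * τ * j) := by ring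
    _ ≤ (D + L * B) * τ * T * Real.exp (L * T) := by gcongr
    _ = _ := by ring

end Abstract

/-! ### The norm of `F` on grid functions and states -/

section GridNorms

variable {N : ℕ} {dx : ℝ}

lemma l2Norm_nonneg (dx : ℝ) (z : Cell N → ℝ) : 0 ≤ l2Norm dx z := Real.sqrt_nonneg _

/-- Identification with a scaled Euclidean norm, from which the norm axioms are inherited. -/
lemma l2Norm_eq (hdx : 0 ≤ dx) (z : Cell N → ℝ) :
    l2Norm dx z = Real.sqrt dx * ‖WithLp.toLp 2 z‖ := by
  rw [l2Norm, Real.sqrt_mul hdx, EuclideanSpace.norm_eq]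
  simp

lemma l2Norm_add_le (hdx : 0 ≤ dx) (z z' : Cell N → ℝ) :
    l2Norm dx (z + z') ≤ l2Norm dx z + l2Norm dx z' := by
  rw [l2Norm_eq hdx, l2Norm_eq hdx, l2Norm_eq hdx, WithLp.toLp_add, ← mul_add]
  exact mul_le_mul_of_nonneg_left (norm_add_le _ _) (Real.sqrt_nonneg _)

lemma l2Norm_smul (hdx : 0 ≤ dx) (a : ℝ) (z : Cell N → ℝ) :
    l2Norm dx (a • z) = |a| * l2Norm dx z := by
  rw [l2Norm_eq hdx, l2Norm_eq hdx, WithLp.toLp_smul, norm_smul, Real.norm_eq_abs]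
  ring

lemma l2Norm_mono (hdx : 0 ≤ dx) {z z' : Cell N → ℝ} (h : ∀ i, |z i| ≤ |z' i|) :
    l2Norm dx z ≤ l2Norm dx z' :=
  Real.sqrt_le_sqrt (mul_le_mul_of_nonneg_left
    (Finset.sum_le_sum fun i _ => sq_le_sq.2 (h i)) hdx)

lemma eq_zero_of_l2Norm_le_zero (hdx : 0 < dx) {z : Cell N → ℝ} (h : l2Norm dx z ≤ 0) : z = 0 := by
  rw [l2Norm_eq hdx.le] at h
  have h1 : ‖WithLp.toLp 2 z‖ = 0 :=
    le_antisymm (nonpos_of_mul_nonpos_right h (Real.sqrt_pos.2 hdx)) (norm_nonneg _)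
  simpa using h1

lemma normF_nonneg (dx : ℝ) (Y : State N) : 0 ≤ normF dx Y := by
  unfold normF
  have h1 := fun z : Cell N → ℝ => l2Norm_nonneg dx z
  linarith [h1 Y.U, h1 Y.v, h1 Y.w, h1 Y.h, norm_nonneg Y.zeta, norm_nonneg Y.U, norm_nonneg Y.H]

lemma normF_components_le (dx : ℝ) (Y : State N) :
    ‖Y.zeta‖ ≤ normF dx Y ∧ l2Norm dx Y.U ≤ normF dx Y ∧ ‖Y.U‖ ≤ normF dx Y ∧
      ‖Y.H‖ ≤ normF dx Y ∧ l2Norm dx Y.v ≤ normF dx Y ∧ l2Norm dx Y.w ≤ normF dx Y ∧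
      l2Norm dx Y.h ≤ normF dx Y := by
  unfold normF
  have h1 := fun z : Cell N → ℝ => l2Norm_nonneg dx z
  refine ⟨?_, ?_, ?_, ?_, ?_, ?_, ?_⟩ <;>
  linarith [h1 Y.U, h1 Y.v, h1 Y.w, h1 Y.h, norm_nonneg Y.zeta, norm_nonneg Y.U, norm_nonneg Y.H]

lemma normF_add_le (hdx : 0 ≤ dx) (Y Y' : State N) :
    normF dx (Y + Y') ≤ normF dx Y + normF dx Y' := by
  have h1 : normF dx (Y + Y') = ‖Y.zeta + Y'.zeta‖ + l2Norm dx (Y.U + Y'.U) + ‖Y.U + Y'.U‖ +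
    ‖Y.H + Y'.H‖ + l2Norm dx (Y.v + Y'.v) + l2Norm dx (Y.w + Y'.w) + l2Norm dx (Y.h + Y'.h) := rfl
  rw [h1, normF, normF]
  linarith [norm_add_le Y.zeta Y'.zeta, l2Norm_add_le hdx Y.U Y'.U, norm_add_le Y.U Y'.U,
    norm_add_le Y.H Y'.H, l2Norm_add_le hdx Y.v Y'.v, l2Norm_add_le hdx Y.w Y'.w,
    l2Norm_add_le hdx Y.h Y'.h]

lemma normF_smul (hdx : 0 ≤ dx) (a : ℝ) (Y : State N) : normF dx (a • Y) = |a| * normF dx Y := by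
  have h1 : normF dx (a • Y) = ‖a • Y.zeta‖ + l2Norm dx (a • Y.U) + ‖a • Y.U‖ +
    ‖a • Y.H‖ + l2Norm dx (a • Y.v) + l2Norm dx (a • Y.w) + l2Norm dx (a • Y.h) := rfl
  rw [h1, normF]
  simp only [l2Norm_smul hdx, norm_smul, Real.norm_eq_abs]
  ring

lemma eq_zero_of_normF_eq_zero (hdx : 0 < dx) {Y : State N} (h : normF dx Y = 0) : Y = 0 := by
  obtain ⟨h0, -, h1, h2, h3, h4, h5⟩ := normF_components_le dx Y
  rw [h] at h0 h1 h2 h3 h4 h5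
  funext k
  fin_cases k
  · exact norm_le_zero_iff.1 h0
  · exact norm_le_zero_iff.1 h1
  · exact norm_le_zero_iff.1 h2
  · exact eq_zero_of_l2Norm_le_zero hdx h3
  · exact eq_zero_of_l2Norm_le_zero hdx h4
  · exact eq_zero_of_l2Norm_le_zero hdx h5

end GridNorms

/-- The space of discrete states with the norm of `F`. -/
def FState (N : ℕ) (_dx : ℝ) : Type := State N

namespace FState

variable {N : ℕ} {dx : ℝ}

noncomputable instance : AddCommGroup (FState N dx) := inferInstanceAs (AddCommGroup (State N))
noncomputable instance : Module ℝ (FState N dx) := inferInstanceAs (Module ℝ (State N))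
instance : FiniteDimensional ℝ (FState N dx) := inferInstanceAs (FiniteDimensional ℝ (State N))
noncomputable instance : Norm (FState N dx) := ⟨fun Y => normF dx (N := N) Y⟩

lemma core [hdx : Fact (0 < dx)] : NormedSpace.Core ℝ (FState N dx) where
  norm_nonneg Y := normF_nonneg dx (N := N) Y
  norm_smul a Y := normF_smul (N := N) hdx.out.le a Y
  norm_triangle Y Y' := normF_add_le (N := N) hdx.out.le Y Y'
  norm_eq_zero_iff Y := by
    refine ⟨fun h => eq_zero_of_normF_eq_zero (N := N) hdx.out h, ?_⟩
    rintro rfl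
    have := normF_smul (N := N) hdx.out.le 0 0
    rw [zero_smul, abs_zero, zero_mul] at this
    exact this

/-- The norm is definite only for positive `dx`, which is therefore carried as a `Fact`;
completeness, needed for the fixed point, comes from finite dimension. -/
noncomputable instance [Fact (0 < dx)] : NormedAddCommGroup (FState N dx) :=
  NormedAddCommGroup.ofCore core
noncomputable instance [Fact (0 < dx)] : NormedSpace ℝ (FState N dx) :=
  NormedSpace.ofCore core
instance [Fact (0 < dx)] : CompleteSpace (FState N dx) := FiniteDimensional.complete ℝ _

/-- The identity from the discrete states with the maximum norm to those with the norm of `F`. -/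
noncomputable def ofState [Fact (0 < dx)] : State N →L[ℝ] FState N dx :=
  LinearMap.toContinuousLinearMap
    ({ toFun := fun Y => Y, map_add' := fun _ _ => rfl, map_smul' := fun _ _ => rfl } :
      State N →ₗ[ℝ] FState N dx)

end FState

/-! ### Explicit cell integrals and Schur's test -/

section Weights

variable {N : ℕ} {dx : ℝ}

/-- The number of cells between the `j`-th cell and the grid point `ξ_i`. -/
def cellGap (i j : Cell N) : ℕ :=
  if (i : ℤ) ≤ j then ((j : ℤ) - i).toNat else ((i : ℤ) - j - 1).toNat

/-- The integral of `exp(-|ξ_i - η|)` over the `j`-th cell. -/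
noncomputable def weight (dx : ℝ) (i j : Cell N) : ℝ :=
  (1 - Real.exp (-dx)) * Real.exp (-dx) ^ cellGap i j

/-- The sign of `ξ_i - η` for `η` in the `j`-th cell. -/
noncomputable def cellSign (i j : Cell N) : ℝ := if (i : ℤ) ≤ j then -1 else 1

lemma abs_cellSign (i j : Cell N) : |cellSign i j| = 1 := by
  unfold cellSign; split_ifs <;> simp

lemma weight_nonneg (hdx : 0 < dx) (i j : Cell N) : 0 ≤ weight dx i j :=
  mul_nonneg (by linarith [Real.exp_lt_one_iff.2 (neg_lt_zero.2 hdx)]) (by positivity)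

lemma weight_le (hdx : 0 < dx) (i j : Cell N) : weight dx i j ≤ dx := by
  have h1 : Real.exp (-dx) ≤ 1 := (Real.exp_lt_one_iff.2 (neg_lt_zero.2 hdx)).le
  calc weight dx i j ≤ (1 - Real.exp (-dx)) * 1 :=
        mul_le_mul_of_nonneg_left (pow_le_one₀ (Real.exp_pos _).le h1) (by linarith)
    _ ≤ dx := by linarith [Real.add_one_le_exp (-dx)]

/-- Distinct exponents make the sum a partial sum of the geometric series. -/
lemma sum_pow_le_of_injOn {ι : Type*} {r : ℝ} (h0 : 0 ≤ r) (h1 : r < 1) (s : Finset ι)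
    {m : ι → ℕ} (hm : Set.InjOn m s) : (1 - r) * ∑ j ∈ s, r ^ m j ≤ 1 := by
  rw [← Finset.sum_image (f := fun n => r ^ n) hm]
  have := (summable_geometric_of_lt_one h0 h1).sum_le_tsum (s.image m) fun _ _ => by positivity
  rw [tsum_geometric_of_lt_one h0 h1] at this
  calc _ ≤ (1 - r) * (1 - r)⁻¹ := mul_le_mul_of_nonneg_left this (by linarith)
    _ = 1 := mul_inv_cancel₀ (by linarith)

/-- On each side of `ξ_i` the gap is an injective function of the cell, so each side contributes at
most 1. -/
lemma sum_weight_right_le (hdx : 0 < dx) (i : Cell N) : ∑ j, weight dx i j ≤ 2 := by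
  have h1 := Real.exp_lt_one_iff.2 (neg_lt_zero.2 hdx)
  have h0 := (Real.exp_pos (-dx)).le
  simp only [weight]
  rw [← Finset.mul_sum, ← Finset.sum_filter_add_sum_filter_not _ fun j : Cell N => (i : ℤ) ≤ j,
    mul_add]
  have ha := sum_pow_le_of_injOn h0 h1 (Finset.univ.filter fun j : Cell N => (i : ℤ) ≤ j)
    (m := fun j => cellGap i j) fun j hj j' hj' e => by
      simp only [Finset.coe_filter, Finset.mem_univ, true_and, Set.mem_ofPred_eq] at hj hj'
      simp only [cellGap, if_pos hj, if_pos hj'] at e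
      exact Subtype.ext (by omega)
  have hb := sum_pow_le_of_injOn h0 h1 (Finset.univ.filter fun j : Cell N => ¬(i : ℤ) ≤ j)
    (m := fun j => cellGap i j) fun j hj j' hj' e => by
      simp only [Finset.coe_filter, Finset.mem_univ, true_and, Set.mem_ofPred_eq] at hj hj'
      simp only [cellGap, if_neg hj, if_neg hj'] at e
      exact Subtype.ext (by omega)
  linarith

lemma sum_weight_left_le (hdx : 0 < dx) (j : Cell N) : ∑ i, weight dx i j ≤ 2 := by
  have h1 := Real.exp_lt_one_iff.2 (neg_lt_zero.2 hdx)
  have h0 := (Real.exp_pos (-dx)).le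
  simp only [weight]
  rw [← Finset.mul_sum, ← Finset.sum_filter_add_sum_filter_not _ fun i : Cell N => (i : ℤ) ≤ j,
    mul_add]
  have ha := sum_pow_le_of_injOn h0 h1 (Finset.univ.filter fun i : Cell N => (i : ℤ) ≤ j)
    (m := fun i => cellGap i j) fun i hi i' hi' e => by
      simp only [Finset.coe_filter, Finset.mem_univ, true_and, Set.mem_ofPred_eq] at hi hi'
      simp only [cellGap, if_pos hi, if_pos hi'] at e
      exact Subtype.ext (by omega)
  have hb := sum_pow_le_of_injOn h0 h1 (Finset.univ.filter fun i : Cell N => ¬(i : ℤ) ≤ j)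
    (m := fun i => cellGap i j) fun i hi i' hi' e => by
      simp only [Finset.coe_filter, Finset.mem_univ, true_and, Set.mem_ofPred_eq] at hi hi'
      simp only [cellGap, if_neg hi, if_neg hi'] at e
      exact Subtype.ext (by omega)
  linarith

/-- Cauchy–Schwarz with respect to the weights, whose total mass is at most 2. -/
lemma sq_sum_weight_mul_le (hdx : 0 < dx) (g : Cell N → ℝ) (i : Cell N) :
    (∑ j, weight dx i j * g j) ^ 2 ≤ 2 * ∑ j, weight dx i j * g j ^ 2 := by
  have hw := fun j => weight_nonneg hdx i j
  refine (Finset.sum_sq_le_sum_mul_sum_of_sq_le_mul _ (f := fun j => weight dx i j)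
    (g := fun j => weight dx i j * g j ^ 2) (fun j _ => hw j)
    (fun j _ => mul_nonneg (hw j) (sq_nonneg _)) fun j _ => le_of_eq (by ring)).trans ?_
  exact mul_le_mul_of_nonneg_right (sum_weight_right_le hdx i)
    (Finset.sum_nonneg fun j _ => mul_nonneg (hw j) (sq_nonneg _))

/-- The Schur test for the weights. -/
lemma l2Norm_sum_weight_mul_le (hdx : 0 < dx) (g : Cell N → ℝ) :
    l2Norm dx (fun i => ∑ j, weight dx i j * g j) ≤ 2 * l2Norm dx g := by
  have h : (2 : ℝ) * l2Norm dx g = Real.sqrt (4 * (dx * ∑ i, g i ^ 2)) := by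
    rw [Real.sqrt_mul (by norm_num), show (4 : ℝ) = 2 ^ 2 by norm_num,
      Real.sqrt_sq (by norm_num), l2Norm]
  rw [h]
  refine Real.sqrt_le_sqrt ?_
  calc dx * ∑ i, (∑ j, weight dx i j * g j) ^ 2
      ≤ dx * ∑ i, 2 * ∑ j, weight dx i j * g j ^ 2 :=
        mul_le_mul_of_nonneg_left
          (Finset.sum_le_sum fun i _ => sq_sum_weight_mul_le hdx g i) hdx.le
    _ = dx * (2 * ∑ j, (∑ i, weight dx i j) * g j ^ 2) := by
        rw [← Finset.mul_sum, Finset.sum_comm]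
        simp only [Finset.sum_mul]
    _ ≤ dx * (2 * ∑ j, 2 * g j ^ 2) := by
        gcongr with j
        exact sum_weight_left_le hdx j
    _ = _ := by rw [← Finset.mul_sum]; ring

/-- After Cauchy–Schwarz, a single weight is at most `dx`, which is exactly the factor in the
discrete `L²` norm. -/
lemma norm_sum_weight_mul_le (hdx : 0 < dx) (g : Cell N → ℝ) :
    ‖fun i => ∑ j, weight dx i j * g j‖ ≤ 2 * l2Norm dx g := by
  refine (pi_norm_le_iff_of_nonneg (mul_nonneg zero_le_two (l2Norm_nonneg _ _))).2 fun i => ?_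
  rw [Real.norm_eq_abs]
  refine abs_le_of_sq_le_sq ?_ (mul_nonneg zero_le_two (l2Norm_nonneg _ _))
  rw [mul_pow, l2Norm, Real.sq_sqrt
    (mul_nonneg hdx.le (Finset.sum_nonneg fun _ _ => sq_nonneg _))]
  calc _ ≤ 2 * ∑ j, weight dx i j * g j ^ 2 := sq_sum_weight_mul_le hdx g i
    _ ≤ 2 * ∑ j, dx * g j ^ 2 := by
        gcongr with j
        exact weight_le hdx i j
    _ ≤ _ := by
        rw [← Finset.mul_sum]
        nlinarith [mul_nonneg hdx.le (Finset.sum_nonneg fun (j : Cell N) (_ : j ∈ Finset.univ) =>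
          sq_nonneg (g j))]

lemma integral_kernel_left {i j : Cell N} (hij : ¬(i : ℤ) ≤ j) (z : ℝ) :
    ∫ η in (gridPt dx j)..(gridPt dx j + dx), Real.exp (z + (η - gridPt dx i)) =
      weight dx i j * Real.exp z := by
  have e : ∀ η, Real.exp (z + (η - gridPt dx i)) = Real.exp (z - gridPt dx i) * Real.exp η :=
    fun η => by rw [← Real.exp_add]; ring_nf
  simp only [e]
  rw [intervalIntegral.integral_const_mul, integral_exp, weight, cellGap, if_neg hij,
    ← Real.exp_nat_mul, mul_sub, sub_mul, sub_mul, ← Real.exp_add, ← Real.exp_add,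
    one_mul, ← Real.exp_add, ← Real.exp_add, ← Real.exp_add]
  -- The truncation is harmless since `j < i`; the `-1` reflects that the right end of cell `j` is
  -- `ξ_{j+1}`.
  have hc : (((i : ℤ) - j - 1).toNat : ℝ) = (i : ℤ) - (j : ℤ) - 1 := by
    rw [← Int.cast_natCast (R := ℝ), Int.toNat_of_nonneg (by omega)]
    push_cast
    ring
  rw [hc]
  congr 1 <;> · congr 1; simp only [gridPt]; ring

lemma integral_kernel_right {i j : Cell N} (hij : (i : ℤ) ≤ j) (z : ℝ) :
    ∫ η in (gridPt dx j)..(gridPt dx j + dx), Real.exp (z - (η - gridPt dx i)) =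
      weight dx i j * Real.exp z := by
  have e : ∀ η, Real.exp (z - (η - gridPt dx i)) = Real.exp (z + gridPt dx i) * Real.exp (-η) :=
    fun η => by rw [← Real.exp_add]; ring_nf
  simp only [e]
  rw [intervalIntegral.integral_const_mul, intervalIntegral.integral_comp_neg Real.exp,
    integral_exp, weight, cellGap, if_pos hij,
    ← Real.exp_nat_mul, mul_sub, sub_mul, sub_mul, ← Real.exp_add, ← Real.exp_add,
    one_mul, ← Real.exp_add, ← Real.exp_add, ← Real.exp_add]
  have hc : (((j : ℤ) - i).toNat : ℝ) = (j : ℤ) - (i : ℤ) := by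
    rw [← Int.cast_natCast (R := ℝ), Int.toNat_of_nonneg (by omega)]
    push_cast
    ring
  rw [hc]
  congr 1 <;> · congr 1; simp only [gridPt]; ring

/-- The open cell is essential: `ξ_i` may be an endpoint of the cell, where the sign is 0. -/
lemma sign_gridPt_sub {i j : Cell N} {η : ℝ} (hdx : 0 < dx)
    (hη : η ∈ Set.Ioo (gridPt dx j) (gridPt dx j + dx)) :
    Real.sign (gridPt dx i - η) = cellSign i j := by
  simp only [gridPt, Set.mem_Ioo] at hη ⊢
  unfold cellSign
  split_ifs with h
  · have : ((i : ℤ) : ℝ) ≤ ((j : ℤ) : ℝ) := by exact_mod_cast h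
    exact Real.sign_of_neg (by nlinarith)
  · have : ((j : ℤ) : ℝ) + 1 ≤ ((i : ℤ) : ℝ) := by exact_mod_cast Int.lt_iff_add_one_le.1 (not_le.1 h)
    exact Real.sign_of_pos (by nlinarith)

lemma integral_kernel (hdx : 0 < dx) (Y : State N) (i j : Cell N) :
    ∫ η in (gridPt dx j)..(gridPt dx j + dx), kernel dx Y i j η =
      weight dx i j * Real.exp (-cellSign i j * (Y.zeta i - Y.zeta j)) := by
  by_cases h : (i : ℤ) ≤ j
  · rw [← integral_kernel_right h]
    refine intervalIntegral.integral_congr_Ioo_of_le (by linarith) fun η hη => ?_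
    simp only [kernel]
    rw [sign_gridPt_sub hdx hη, cellSign, if_pos h]
    ring_nf
  · rw [← integral_kernel_left h]
    refine intervalIntegral.integral_congr_Ioo_of_le (by linarith) fun η hη => ?_
    simp only [kernel]
    rw [sign_gridPt_sub hdx hη, cellSign, if_neg h]
    ring_nf

/-- The discrete convolution of `s` with the kernel, weighted by `θ`. -/
noncomputable def cellConv (θ : Cell N → Cell N → ℝ) (dx : ℝ) (Y : State N) (s : Cell N → ℝ)
    (i : Cell N) : ℝ :=
  ∑ j, θ i j * weight dx i j * Real.exp (-cellSign i j * (Y.zeta i - Y.zeta j)) * s j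

lemma P_eq (hdx : 0 < dx) (γ : ℝ) (Y : State N) :
    P γ dx Y = (1 / 2 : ℝ) • cellConv (fun _ _ => 1) dx Y (source γ Y) := by
  funext i
  simp only [P, cellConv, Pi.smul_apply, smul_eq_mul, one_mul]
  congr 1
  refine Finset.sum_congr rfl fun j _ => ?_
  rw [intervalIntegral.integral_mul_const, integral_kernel hdx]

lemma Q_eq (hdx : 0 < dx) (γ : ℝ) (Y : State N) :
    Q γ dx Y = (-(1 / 2) : ℝ) • cellConv cellSign dx Y (source γ Y) := by
  funext i
  simp only [Q, cellConv, Pi.smul_apply, smul_eq_mul]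
  congr 1
  refine Finset.sum_congr rfl fun j _ => ?_
  rw [mul_assoc (cellSign i j), ← integral_kernel hdx, intervalIntegral.integral_mul_const]
  congr 1
  rw [← intervalIntegral.integral_const_mul]
  refine intervalIntegral.integral_congr_Ioo_of_le (by linarith) fun η hη => ?_
  simp only [sign_gridPt_sub hdx hη]

end Weights

/-! ### Bounds and Lipschitz constants uniform in the grid -/

section LipBdd

/-- The properties of the discrete `L²` and maximum norms that the estimates use. -/
structure IsGridNorm (ν : ∀ N : ℕ, ℝ → (Cell N → ℝ) → ℝ) : Prop where
  add_le : ∀ (N : ℕ) (dx : ℝ), 0 < dx → ∀ z z', ν N dx (z + z') ≤ ν N dx z + ν N dx z'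
  smul : ∀ (N : ℕ) (dx : ℝ), 0 < dx → ∀ (a : ℝ) z, ν N dx (a • z) = |a| * ν N dx z
  mono : ∀ (N : ℕ) (dx : ℝ), 0 < dx → ∀ z z', (∀ i, |z i| ≤ |z' i|) → ν N dx z ≤ ν N dx z'
  sum_weight_mul_le : ∀ (N : ℕ) (dx : ℝ), 0 < dx → ∀ g,
    ν N dx (fun i => ∑ j, weight dx i j * g j) ≤ 2 * l2Norm dx g

/-- The maximum norm, as a family indexed by the grids. -/
noncomputable def supNorm (N : ℕ) (_dx : ℝ) (z : Cell N → ℝ) : ℝ := ‖z‖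

/-- The discrete `L²` norm, as a family indexed by the grids. -/
noncomputable def l2 (N : ℕ) (dx : ℝ) (z : Cell N → ℝ) : ℝ := l2Norm dx z

lemma isGridNorm_supNorm : IsGridNorm supNorm where
  add_le _ _ _ z z' := norm_add_le z z'
  smul _ _ _ a z := norm_smul a z
  mono _ _ _ _ z' h := (pi_norm_le_iff_of_nonneg (norm_nonneg z')).2 fun i =>
    (h i).trans (norm_le_pi_norm z' i)
  sum_weight_mul_le _ _ hdx g := norm_sum_weight_mul_le hdx g

lemma isGridNorm_l2 : IsGridNorm l2 where
  add_le _ _ hdx z z' := l2Norm_add_le hdx.le z z'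
  smul _ _ hdx a z := l2Norm_smul hdx.le a z
  mono _ _ hdx _ _ h := l2Norm_mono hdx.le h
  sum_weight_mul_le _ _ hdx g := l2Norm_sum_weight_mul_le hdx g

variable {ν : ∀ N : ℕ, ℝ → (Cell N → ℝ) → ℝ}

lemma IsGridNorm.mul_le (hν : IsGridNorm ν) {N : ℕ} {dx : ℝ} (hdx : 0 < dx) (z z' : Cell N → ℝ) :
    ν N dx (z * z') ≤ ‖z‖ * ν N dx z' := by
  rw [← abs_of_nonneg (norm_nonneg z), ← hν.smul N dx hdx]
  refine hν.mono N dx hdx _ _ fun i => ?_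
  rw [Pi.mul_apply, Pi.smul_apply, smul_eq_mul, abs_mul, abs_mul, abs_norm]
  exact mul_le_mul_of_nonneg_right (norm_le_pi_norm z i) (abs_nonneg _)

/-- A family of grid functions of the discrete state is bounded and Lipschitz continuous on the
ball of radius `r`, uniformly in the grid. -/
def LipBdd (ν : ∀ N : ℕ, ℝ → (Cell N → ℝ) → ℝ) (r : ℝ)
    (f : ∀ N : ℕ, ℝ → State N → Cell N → ℝ) : Prop :=
  ∃ C : ℝ, 0 ≤ C ∧ ∀ (N : ℕ) (dx : ℝ), 0 < dx → ∀ Y : State N, normF dx Y ≤ r →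
    ν N dx (f N dx Y) ≤ C ∧ ∀ Y' : State N, normF dx Y' ≤ r →
      ν N dx (f N dx Y - f N dx Y') ≤ C * normF dx (Y - Y')

variable {r : ℝ} {f g : ∀ N : ℕ, ℝ → State N → Cell N → ℝ}

lemma LipBdd.add (hν : IsGridNorm ν) (hf : LipBdd ν r f) (hg : LipBdd ν r g) :
    LipBdd ν r (fun N dx Y => f N dx Y + g N dx Y) := by
  obtain ⟨C, hC, h1⟩ := hf
  obtain ⟨C', hC', h2⟩ := hg
  refine ⟨C + C', by positivity, fun N dx hdx Y hY => ⟨?_, fun Y' hY' => ?_⟩⟩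
  · exact (hν.add_le N dx hdx _ _).trans (add_le_add (h1 N dx hdx Y hY).1 (h2 N dx hdx Y hY).1)
  · rw [add_sub_add_comm, add_mul]
    exact (hν.add_le N dx hdx _ _).trans
      (add_le_add ((h1 N dx hdx Y hY).2 Y' hY') ((h2 N dx hdx Y hY).2 Y' hY'))

lemma LipBdd.const_smul (hν : IsGridNorm ν) (hf : LipBdd ν r f) (a : ℝ) :
    LipBdd ν r (fun N dx Y => a • f N dx Y) := by
  obtain ⟨C, hC, h1⟩ := hf
  refine ⟨|a| * C, by positivity, fun N dx hdx Y hY => ⟨?_, fun Y' hY' => ?_⟩⟩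
  · rw [hν.smul N dx hdx]
    exact mul_le_mul_of_nonneg_left (h1 N dx hdx Y hY).1 (abs_nonneg _)
  · rw [← smul_sub, hν.smul N dx hdx, mul_assoc]
    exact mul_le_mul_of_nonneg_left ((h1 N dx hdx Y hY).2 Y' hY') (abs_nonneg _)

/-- Only one factor needs a maximum-norm bound; this matters because the `F` norm controls `v`, `w`,
`h` in `L²` only. -/
lemma LipBdd.mul (hν : IsGridNorm ν) (hf : LipBdd supNorm r f) (hg : LipBdd ν r g) :
    LipBdd ν r (fun N dx Y => f N dx Y * g N dx Y) := by
  obtain ⟨C, hC, h1⟩ := hf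
  obtain ⟨C', hC', h2⟩ := hg
  refine ⟨C * C' + 2 * (C * C'), by positivity, fun N dx hdx Y hY => ⟨?_, fun Y' hY' => ?_⟩⟩
  · have a1 := (h1 N dx hdx Y hY).1
    have a2 := (h2 N dx hdx Y hY).1
    have h3 := hν.mul_le hdx (f N dx Y) (g N dx Y)
    have h4 : ‖f N dx Y‖ * ν N dx (g N dx Y) ≤ C * C' :=
      (mul_le_mul_of_nonneg_left a2 (norm_nonneg _)).trans (mul_le_mul_of_nonneg_right a1 hC')
    linarith [mul_nonneg hC hC']
  · have e : f N dx Y * g N dx Y - f N dx Y' * g N dx Y' =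
        f N dx Y * (g N dx Y - g N dx Y') + (f N dx Y - f N dx Y') * g N dx Y' := by ring
    rw [e]
    have hn := normF_nonneg dx (Y - Y')
    have a1 := (h1 N dx hdx Y hY).1
    have a2 := (h2 N dx hdx Y' hY').1
    have b1 := (h1 N dx hdx Y hY).2 Y' hY'
    have b2 := (h2 N dx hdx Y hY).2 Y' hY'
    have c1 : ‖f N dx Y‖ * ν N dx (g N dx Y - g N dx Y') ≤ C * (C' * normF dx (Y - Y')) :=
      (mul_le_mul_of_nonneg_left b2 (norm_nonneg _)).trans
        (mul_le_mul_of_nonneg_right a1 (by positivity))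
    have c2 : ‖f N dx Y - f N dx Y'‖ * ν N dx (g N dx Y') ≤ C * normF dx (Y - Y') * C' :=
      (mul_le_mul_of_nonneg_left a2 (norm_nonneg _)).trans (mul_le_mul_of_nonneg_right b1 hC')
    have d1 := hν.mul_le hdx (f N dx Y) (g N dx Y - g N dx Y')
    have d2 := hν.mul_le hdx (f N dx Y - f N dx Y') (g N dx Y')
    have d3 := hν.add_le N dx hdx (f N dx Y * (g N dx Y - g N dx Y'))
      ((f N dx Y - f N dx Y') * g N dx Y')
    have : 0 ≤ C * C' * normF dx (Y - Y') := by positivity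
    linarith

lemma lipBdd_of_norm_le (r : ℝ) (hsub : ∀ N dx Y Y', f N dx Y - f N dx Y' = f N dx (Y - Y'))
    (hle : ∀ N dx Y, ν N dx (f N dx Y) ≤ normF dx Y) : LipBdd ν r f := by
  -- `|r|` serves the bound, also for negative `r`, and `1` serves the Lipschitz estimate.
  refine ⟨|r| + 1, by positivity, fun N dx _ Y hY => ⟨?_, fun Y' _ => ?_⟩⟩
  · linarith [hle N dx Y, le_abs_self r]
  · rw [hsub]
    nlinarith [hle N dx (Y - Y'), normF_nonneg dx (Y - Y'), abs_nonneg r]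

lemma lipBdd_U (r : ℝ) : LipBdd supNorm r (fun _ _ Y => Y.U) :=
  lipBdd_of_norm_le r (fun _ _ _ _ => rfl) fun _ dx Y => (normF_components_le dx Y).2.2.1

lemma lipBdd_U_l2 (r : ℝ) : LipBdd l2 r (fun _ _ Y => Y.U) :=
  lipBdd_of_norm_le r (fun _ _ _ _ => rfl) fun _ dx Y => (normF_components_le dx Y).2.1

lemma lipBdd_v (r : ℝ) : LipBdd l2 r (fun _ _ Y => Y.v) :=
  lipBdd_of_norm_le r (fun _ _ _ _ => rfl) fun _ dx Y => (normF_components_le dx Y).2.2.2.2.1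

lemma lipBdd_w (r : ℝ) : LipBdd l2 r (fun _ _ Y => Y.w) :=
  lipBdd_of_norm_le r (fun _ _ _ _ => rfl) fun _ dx Y => (normF_components_le dx Y).2.2.2.2.2.1

lemma lipBdd_h (r : ℝ) : LipBdd l2 r (fun _ _ Y => Y.h) :=
  lipBdd_of_norm_le r (fun _ _ _ _ => rfl) fun _ dx Y => (normF_components_le dx Y).2.2.2.2.2.2

/-- In `q = 1 + v` the constant 1 has no `L²` bound uniform in the grid, so `f` must itself be
controlled in `L²` as well as in the maximum norm. -/
lemma LipBdd.mul_q (hf : LipBdd supNorm r f) (hf' : LipBdd l2 r f) :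
    LipBdd l2 r (fun N dx Y => f N dx Y * Y.q) := by
  have := hf'.add isGridNorm_l2 (hf.mul isGridNorm_l2 (lipBdd_v r))
  convert this using 5 with N dx Y
  funext i
  simp only [Pi.mul_apply, Pi.add_apply, State.q]
  ring

lemma abs_exp_sub_exp_le {a b m : ℝ} (ha : a ≤ m) (hb : b ≤ m) :
    |Real.exp a - Real.exp b| ≤ Real.exp m * |a - b| := by
  wlog hab : b ≤ a generalizing a b
  · rw [abs_sub_comm, abs_sub_comm a]
    exact this hb ha (le_of_not_ge hab)
  rw [abs_of_nonneg (sub_nonneg.2 (Real.exp_le_exp.2 hab)), abs_of_nonneg (sub_nonneg.2 hab)]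
  have h1 : Real.exp b = Real.exp a * Real.exp (b - a) := by rw [← Real.exp_add]; ring_nf
  calc Real.exp a - Real.exp b = Real.exp a * (1 - Real.exp (b - a)) := by rw [h1]; ring
    _ ≤ Real.exp a * (a - b) :=
      mul_le_mul_of_nonneg_left (by linarith [Real.add_one_le_exp (b - a)]) (Real.exp_pos _).le
    _ ≤ _ := mul_le_mul_of_nonneg_right (Real.exp_le_exp.2 ha) (sub_nonneg.2 hab)

lemma neg_cellSign_mul_le {N : ℕ} {dx : ℝ} {Y : State N} (hY : normF dx Y ≤ r) (i j : Cell N) :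
    -cellSign i j * (Y.zeta i - Y.zeta j) ≤ 2 * r := by
  have h := (normF_components_le dx Y).1.trans hY
  refine (le_abs_self _).trans ?_
  rw [abs_mul, abs_neg, abs_cellSign, one_mul]
  have h1 := norm_le_pi_norm Y.zeta i
  have h2 := norm_le_pi_norm Y.zeta j
  rw [Real.norm_eq_abs] at h1 h2
  linarith [abs_sub (Y.zeta i) (Y.zeta j)]

/-- The exponents are at most `2 r`, so the kernel is dominated by `exp (2 r)` times the weights. A
difference is split into the change of `f` and the change of the exponential, and both parts go
through the weighted-sum bound. -/
lemma LipBdd.cellConv (hν : IsGridNorm ν) (θ : ∀ N : ℕ, Cell N → Cell N → ℝ)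
    (hθ : ∀ N i j, |θ N i j| ≤ 1) (hf : LipBdd l2 r f) :
    LipBdd ν r (fun N dx Y => cellConv (θ N) dx Y (f N dx Y)) := by
  obtain ⟨C, hC, h1⟩ := hf
  set e := Real.exp (2 * r) with he
  have he0 : 0 < e := Real.exp_pos _
  -- `6 = 2 (1 + 2)`: the factor 2 of the weighted-sum bound, one `e * C` from the change of `f` and
  -- two from the change of the exponent.
  refine ⟨6 * (e * C), by positivity, fun N dx hdx Y hY => ⟨?_, fun Y' hY' => ?_⟩⟩
  · have h2 : ν N dx (HyperelasticRod.cellConv (θ N) dx Y (f N dx Y)) ≤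
        ν N dx (fun i => ∑ j, weight dx i j * (e * |f N dx Y j|)) := by
      refine hν.mono N dx hdx _ _ fun i => le_trans ?_ (le_abs_self _)
      refine (Finset.abs_sum_le_sum_abs _ _).trans (Finset.sum_le_sum fun j _ => ?_)
      have hE := Real.exp_le_exp.2 (neg_cellSign_mul_le hY i j)
      rw [abs_mul, abs_mul, abs_mul, abs_of_nonneg (weight_nonneg hdx i j), Real.abs_exp,
        mul_assoc _ _ |_|]
      calc _ ≤ 1 * weight dx i j * (e * |f N dx Y j|) := by
            have := weight_nonneg hdx i j
            gcongr
            exact hθ N i j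
        _ = _ := by ring
    have h3 : l2Norm dx (fun j => e * |f N dx Y j|) ≤ e * l2Norm dx (f N dx Y) := by
      rw [← abs_of_pos he0, ← l2Norm_smul hdx.le]
      refine l2Norm_mono hdx.le fun j => ?_
      simp [abs_mul]
    have h4 := hν.sum_weight_mul_le N dx hdx (fun j => e * |f N dx Y j|)
    have h5 := mul_le_mul_of_nonneg_left (h1 N dx hdx Y hY).1 he0.le
    have h6 : 0 ≤ e * C := by positivity
    rw [l2] at h5
    linarith
  · set n := normF dx (Y - Y') with hn
    have hn0 : 0 ≤ n := normF_nonneg dx (Y - Y')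
    let g₁ : Cell N → ℝ := e • (f N dx Y - f N dx Y')
    let g₂ : Cell N → ℝ := (2 * e * n) • f N dx Y'
    have h2 : ν N dx (HyperelasticRod.cellConv (θ N) dx Y (f N dx Y) -
        HyperelasticRod.cellConv (θ N) dx Y' (f N dx Y')) ≤
        ν N dx (fun i => ∑ j, weight dx i j * (|g₁ j| + |g₂ j|)) := by
      refine hν.mono N dx hdx _ _ fun i => le_trans ?_ (le_abs_self _)
      simp only [HyperelasticRod.cellConv, Pi.sub_apply]
      rw [← Finset.sum_sub_distrib]
      refine (Finset.abs_sum_le_sum_abs _ _).trans (Finset.sum_le_sum fun j _ => ?_)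
      set x := -cellSign i j * (Y.zeta i - Y.zeta j) with hx
      set x' := -cellSign i j * (Y'.zeta i - Y'.zeta j) with hx'
      have hxr : x ≤ 2 * r := neg_cellSign_mul_le hY i j
      have hE := Real.exp_le_exp.2 hxr
      have hE' : |Real.exp x - Real.exp x'| ≤ e * (2 * n) := by
        refine (abs_exp_sub_exp_le hxr (neg_cellSign_mul_le hY' i j)).trans
          (mul_le_mul_of_nonneg_left ?_ he0.le)
        have e1 : x - x' = -cellSign i j * ((Y - Y').zeta i - (Y - Y').zeta j) := by
          simp only [hx, hx', State.zeta, Pi.sub_apply]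
          ring
        have h3 := (normF_components_le dx (Y - Y')).1
        have h4 := norm_le_pi_norm (Y - Y').zeta i
        have h5 := norm_le_pi_norm (Y - Y').zeta j
        rw [Real.norm_eq_abs] at h4 h5
        rw [e1, abs_mul, abs_neg, abs_cellSign, one_mul]
        linarith [abs_sub ((Y - Y').zeta i) ((Y - Y').zeta j)]
      have e2 : θ N i j * weight dx i j * Real.exp x * f N dx Y j -
          θ N i j * weight dx i j * Real.exp x' * f N dx Y' j = θ N i j * (weight dx i j *
          (Real.exp x * (f N dx Y j - f N dx Y' j) +
            (Real.exp x - Real.exp x') * f N dx Y' j)) := by ring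
      have hg1 : |Real.exp x * (f N dx Y j - f N dx Y' j)| ≤ |g₁ j| := by
        simp only [g₁, Pi.smul_apply, Pi.sub_apply, smul_eq_mul]
        rw [abs_mul, abs_mul, Real.abs_exp, abs_of_pos he0]
        exact mul_le_mul_of_nonneg_right hE (abs_nonneg _)
      have hg2 : |(Real.exp x - Real.exp x') * f N dx Y' j| ≤ |g₂ j| := by
        simp only [g₂, Pi.smul_apply, smul_eq_mul]
        rw [abs_mul, abs_mul (2 * e * n), abs_of_nonneg (show 0 ≤ 2 * e * n by positivity)]
        exact mul_le_mul_of_nonneg_right (hE'.trans (le_of_eq (by ring))) (abs_nonneg _)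
      rw [e2, abs_mul, abs_mul, abs_of_nonneg (weight_nonneg hdx i j)]
      have h3 := weight_nonneg hdx i j
      calc _ ≤ 1 * (weight dx i j * (|g₁ j| + |g₂ j|)) := by
            gcongr
            · exact hθ N i j
            · exact (abs_add_le _ _).trans (add_le_add hg1 hg2)
        _ = _ := one_mul _
    have h3 : l2Norm dx (fun j => |g₁ j| + |g₂ j|) ≤ l2Norm dx g₁ + l2Norm dx g₂ := by
      have h := l2Norm_add_le hdx.le (fun j => |g₁ j|) (fun j => |g₂ j|)
      have ha : ∀ g : Cell N → ℝ, l2Norm dx (fun j => |g j|) ≤ l2Norm dx g := fun g =>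
        l2Norm_mono hdx.le fun j => (abs_abs (g j)).le
      exact h.trans (add_le_add (ha g₁) (ha g₂))
    have h4 := hν.sum_weight_mul_le N dx hdx (fun j => |g₁ j| + |g₂ j|)
    have h5 : l2Norm dx g₁ ≤ e * (C * n) := by
      rw [l2Norm_smul hdx.le, abs_of_pos he0]
      exact mul_le_mul_of_nonneg_left ((h1 N dx hdx Y hY).2 Y' hY') he0.le
    have h6 : l2Norm dx g₂ ≤ 2 * e * n * C := by
      rw [l2Norm_smul hdx.le, abs_of_nonneg (show 0 ≤ 2 * e * n by positivity)]
      exact mul_le_mul_of_nonneg_left (h1 N dx hdx Y' hY').1 (by positivity)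
    linarith

lemma lipBdd_source (γ r : ℝ) : LipBdd l2 r (fun _ _ Y => source γ Y) := by
  have hU := lipBdd_U r
  have h1 := ((hU.mul isGridNorm_supNorm hU).mul_q (hU.mul isGridNorm_l2 (lipBdd_U_l2 r))).const_smul
    isGridNorm_l2 ((3 - 2 * γ) / 2)
  convert h1.add isGridNorm_l2 ((lipBdd_h r).const_smul isGridNorm_l2 (γ / 2)) using 5 with N dx Y
  funext i
  simp only [source, Pi.add_apply, Pi.smul_apply, Pi.mul_apply, smul_eq_mul]
  ring

lemma LipBdd.congr (hf : LipBdd ν r f) (h : ∀ N dx, 0 < dx → ∀ Y, g N dx Y = f N dx Y) :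
    LipBdd ν r g := by
  obtain ⟨C, hC, h1⟩ := hf
  refine ⟨C, hC, fun N dx hdx Y hY => ?_⟩
  simp only [h N dx hdx]
  exact h1 N dx hdx Y hY

lemma lipBdd_P (hν : IsGridNorm ν) (γ r : ℝ) : LipBdd ν r (fun _ dx Y => P γ dx Y) :=
  (((lipBdd_source γ r).cellConv hν (fun _ _ _ => 1) fun _ _ _ => by simp).const_smul hν
    (1 / 2)).congr fun _ _ hdx Y => P_eq hdx γ Y

lemma lipBdd_Q (hν : IsGridNorm ν) (γ r : ℝ) : LipBdd ν r (fun _ dx Y => Q γ dx Y) :=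
  (((lipBdd_source γ r).cellConv hν (fun _ => cellSign) fun _ i j =>
    (abs_cellSign i j).le).const_smul hν (-(1 / 2))).congr fun _ _ hdx Y => Q_eq hdx γ Y

lemma lipBdd_zero (hν : IsGridNorm ν) (r : ℝ) : LipBdd ν r (fun _ _ _ => 0) := by
  have h0 : ∀ N dx, 0 < dx → ν N dx 0 = 0 := fun N dx hdx => by
    have := hν.smul N dx hdx 0 0
    rwa [zero_smul, abs_zero, zero_mul] at this
  refine ⟨0, le_rfl, fun N dx hdx Y _ => ⟨(h0 N dx hdx).le, fun Y' _ => ?_⟩⟩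
  rw [sub_zero, zero_mul]
  exact (h0 N dx hdx).le

/-- A vector field whose components are bounded and Lipschitz continuous uniformly in the grid
has the same property in the norm of `F`. -/
lemma exists_bound_of_lipBdd {r : ℝ} {X : ∀ N : ℕ, ℝ → State N → State N}
    (h0 : LipBdd supNorm r fun N dx Y => (X N dx Y).zeta)
    (h1 : LipBdd supNorm r fun N dx Y => (X N dx Y).U) (h1' : LipBdd l2 r fun N dx Y => (X N dx Y).U)
    (h2 : LipBdd supNorm r fun N dx Y => (X N dx Y).H)
    (h3 : LipBdd l2 r fun N dx Y => (X N dx Y).v) (h4 : LipBdd l2 r fun N dx Y => (X N dx Y).w)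
    (h5 : LipBdd l2 r fun N dx Y => (X N dx Y).h) :
    ∃ C : ℝ, 0 ≤ C ∧ ∀ (N : ℕ) (dx : ℝ), 0 < dx → ∀ Y : State N, normF dx Y ≤ r →
      normF dx (X N dx Y) ≤ C ∧ ∀ Y' : State N, normF dx Y' ≤ r →
        normF dx (X N dx Y - X N dx Y') ≤ C * normF dx (Y - Y') := by
  obtain ⟨C0, hC0, h0⟩ := h0
  obtain ⟨C1, hC1, h1⟩ := h1
  obtain ⟨D1, hD1, h1'⟩ := h1'
  obtain ⟨C2, hC2, h2⟩ := h2
  obtain ⟨C3, hC3, h3⟩ := h3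
  obtain ⟨C4, hC4, h4⟩ := h4
  obtain ⟨C5, hC5, h5⟩ := h5
  refine ⟨C0 + D1 + C1 + C2 + C3 + C4 + C5, by positivity, fun N dx hdx Y hY =>
    ⟨?_, fun Y' hY' => ?_⟩⟩
  · unfold normF
    exact add_le_add (add_le_add (add_le_add (add_le_add (add_le_add (add_le_add
      (h0 N dx hdx Y hY).1 (h1' N dx hdx Y hY).1) (h1 N dx hdx Y hY).1) (h2 N dx hdx Y hY).1)
      (h3 N dx hdx Y hY).1) (h4 N dx hdx Y hY).1) (h5 N dx hdx Y hY).1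
  · simp only [add_mul]
    rw [normF]
    exact add_le_add (add_le_add (add_le_add (add_le_add (add_le_add (add_le_add
      ((h0 N dx hdx Y hY).2 Y' hY') ((h1' N dx hdx Y hY).2 Y' hY'))
      ((h1 N dx hdx Y hY).2 Y' hY')) ((h2 N dx hdx Y hY).2 Y' hY'))
      ((h3 N dx hdx Y hY).2 Y' hY')) ((h4 N dx hdx Y hY).2 Y' hY')) ((h5 N dx hdx Y hY).2 Y' hY')

lemma fieldG₁_bound (γ r : ℝ) :
    ∃ C : ℝ, 0 ≤ C ∧ ∀ (N : ℕ) (dx : ℝ), 0 < dx → ∀ Y : State N, normF dx Y ≤ r →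
      normF dx (fieldG₁ γ dx Y) ≤ C ∧ ∀ Y' : State N, normF dx Y' ≤ r →
        normF dx (fieldG₁ γ dx Y - fieldG₁ γ dx Y') ≤ C * normF dx (Y - Y') := by
  have hs := isGridNorm_supNorm
  have hl := isGridNorm_l2
  have hU := lipBdd_U r
  have hUU := hU.mul hs hU
  refine exists_bound_of_lipBdd (X := fun N dx Y => fieldG₁ γ dx Y) (lipBdd_zero hs r)
    (lipBdd_zero hs r) (lipBdd_zero hl r) (lipBdd_zero hs r) ?_ ?_ ?_
  · exact (lipBdd_w r).const_smul hl γ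
  · have h1 := (hUU.const_smul hs ((3 - 2 * γ) / 2)).add hs ((lipBdd_P hs γ r).const_smul hs (-1))
    have h2 := ((hU.mul hl (lipBdd_U_l2 r)).const_smul hl ((3 - 2 * γ) / 2)).add hl
      ((lipBdd_P hl γ r).const_smul hl (-1))
    refine (((lipBdd_h r).const_smul hl (γ / 2)).add hl (h1.mul_q h2)).congr fun N dx _ Y => ?_
    funext i
    simp only [Pi.add_apply, Pi.smul_apply, Pi.mul_apply, smul_eq_mul]
    change γ / 2 * Y.h i + ((3 - 2 * γ) / 2 * Y.U i ^ 2 - P γ dx Y i) * Y.q i = _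
    ring
  · refine (((hUU.const_smul hs 3).add hs ((lipBdd_P hs γ r).const_smul hs (-2))).mul hl
      (lipBdd_w r)).congr fun N dx _ Y => ?_
    funext i
    simp only [Pi.add_apply, Pi.smul_apply, Pi.mul_apply, smul_eq_mul]
    change (3 * Y.U i ^ 2 - 2 * P γ dx Y i) * Y.w i = _
    ring

lemma fieldG₂_bound (γ r : ℝ) :
    ∃ C : ℝ, 0 ≤ C ∧ ∀ (N : ℕ) (dx : ℝ), 0 < dx → ∀ Y : State N, normF dx Y ≤ r →
      normF dx (fieldG₂ γ dx Y) ≤ C ∧ ∀ Y' : State N, normF dx Y' ≤ r →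
        normF dx (fieldG₂ γ dx Y - fieldG₂ γ dx Y') ≤ C * normF dx (Y - Y') := by
  have hs := isGridNorm_supNorm
  have hl := isGridNorm_l2
  have hU := lipBdd_U r
  have hneg : ∀ N (dx : ℝ), 0 < dx → ∀ Y : State N, (fieldG₂ γ dx Y).U = (-1 : ℝ) • Q γ dx Y :=
    fun N dx _ Y => by
      rw [neg_one_smul]
      rfl
  refine exists_bound_of_lipBdd (X := fun N dx Y => fieldG₂ γ dx Y) (hU.const_smul hs γ)
    (((lipBdd_Q hs γ r).const_smul hs (-1)).congr hneg)
    (((lipBdd_Q hl γ r).const_smul hl (-1)).congr hneg) ?_ (lipBdd_zero hl r) (lipBdd_zero hl r) ?_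
  · refine ((hU.mul hs (hU.mul hs hU)).add hs
      (((lipBdd_P hs γ r).mul hs hU).const_smul hs (-2))).congr fun N dx _ Y => ?_
    funext i
    simp only [Pi.add_apply, Pi.smul_apply, Pi.mul_apply, smul_eq_mul]
    change Y.U i ^ 3 - 2 * P γ dx Y i * Y.U i = _
    ring
  · refine ((((lipBdd_Q hs γ r).mul hs hU).mul_q
      ((lipBdd_Q hs γ r).mul hl (lipBdd_U_l2 r))).const_smul hl (-2)).congr fun N dx _ Y => ?_
    funext i
    simp only [Pi.smul_apply, Pi.mul_apply, smul_eq_mul]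
    change -2 * Q γ dx Y i * Y.U i * Y.q i = _
    ring

lemma fieldG_eq {N : ℕ} (γ dx : ℝ) (Y : State N) :
    fieldG γ dx Y = fieldG₁ γ dx Y + fieldG₂ γ dx Y := by
  funext k i
  fin_cases k
  · exact (zero_add (γ * Y.U i)).symm
  · exact (zero_add (-Q γ dx Y i)).symm
  · exact (zero_add (Y.U i ^ 3 - 2 * P γ dx Y i * Y.U i)).symm
  · exact (add_zero (γ * Y.w i)).symm
  · exact (add_zero
      (γ / 2 * Y.h i + ((3 - 2 * γ) / 2 * Y.U i ^ 2 - P γ dx Y i) * Y.q i)).symm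
  · exact add_comm (-2 * Q γ dx Y i * Y.U i * Y.q i) ((3 * Y.U i ^ 2 - 2 * P γ dx Y i) * Y.w i)

end LipBdd

/-! ### The conserved energy gap and positivity of the densities -/

section Positivity

variable {N s : ℕ} {dx γ τ ρ r : ℝ} {rk : RungeKutta s}

lemma add_smul_sum_apply (Y : State N) (τ : ℝ) (c : Fin s → ℝ) (K : Fin s → State N) (k : Fin 6)
    (i : Cell N) : (Y + τ • ∑ j, c j • K j) k i = Y k i + τ * ∑ j, c j * K j k i := by
  simp [Finset.sum_apply]

lemma q_add_smul_sum (Y : State N) (τ : ℝ) (c : Fin s → ℝ) (K : Fin s → State N) (i : Cell N) :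
    (Y + τ • ∑ j, c j • K j).q i = Y.q i + τ * ∑ j, c j * (K j).v i := by
  simp only [State.q, State.v]
  rw [add_smul_sum_apply]
  ring

/-- The quantity `q h - (U q)² - w²`, which vanishes or is positive for admissible states. -/
def energyGap (Y : State N) (i : Cell N) : ℝ :=
  Y.q i * Y.h i - (Y.U i * Y.q i) ^ 2 - Y.w i ^ 2

/-- With `U` frozen, the product rule is applied to `q h`, `q²` and `w²`; at each stage the
resulting combination vanishes identically, the terms with `P` cancelling. -/
lemma energyGap_step₁ (hq : rk.PreservesQuadratic) {Y Z : State N}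
    (h : rk.IsStep dx ρ (fieldG₁ γ dx) τ Y Z) (i : Cell N) : energyGap Z i = energyGap Y i := by
  obtain ⟨K, hK, -, rfl⟩ := h
  have hU : ∀ j, (K j).U i = 0 := fun j => by rw [hK j]; rfl
  have hSU : ∀ c : Fin s → ℝ, (Y + τ • ∑ j, c j • K j).U i = Y.U i := fun c => by
    refine (add_smul_sum_apply Y τ c K 1 i).trans ?_
    have : ∀ j, K j 1 i = 0 := hU
    simp only [this, mul_zero, Finset.sum_const_zero, add_zero]
    rfl
  have hw : ∀ c : Fin s → ℝ, (Y + τ • ∑ j, c j • K j).w i = Y.w i + τ * ∑ j, c j * (K j).w i :=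
    fun c => add_smul_sum_apply Y τ c K 4 i
  have hh : ∀ c : Fin s → ℝ, (Y + τ • ∑ j, c j • K j).h i = Y.h i + τ * ∑ j, c j * (K j).h i :=
    fun c => add_smul_sum_apply Y τ c K 5 i
  have e1 := hq.mul_sub_mul (τ := τ) (Y.q i) (Y.h i) (fun j => (K j).v i) (fun j => (K j).h i)
  have e2 := hq.mul_sub_mul (τ := τ) (Y.q i) (Y.q i) (fun j => (K j).v i) (fun j => (K j).v i)
  have e3 := hq.mul_sub_mul (τ := τ) (Y.w i) (Y.w i) (fun j => (K j).w i) (fun j => (K j).w i)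
  simp only [← q_add_smul_sum, ← hw, ← hh] at e1 e2 e3
  have e4 : ∀ j, rk.b j *
      ((Y + τ • ∑ l, rk.a j l • K l).q i * (K j).h i +
        (Y + τ • ∑ l, rk.a j l • K l).h i * (K j).v i) - Y.U i ^ 2 * (rk.b j *
      ((Y + τ • ∑ l, rk.a j l • K l).q i * (K j).v i +
        (Y + τ • ∑ l, rk.a j l • K l).q i * (K j).v i)) - rk.b j *
      ((Y + τ • ∑ l, rk.a j l • K l).w i * (K j).w i +
        (Y + τ • ∑ l, rk.a j l • K l).w i * (K j).w i) = 0 := fun j => by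
    have hSUj := hSU (rk.a j)
    have hKj := hK j
    set S := Y + τ • ∑ l, rk.a j l • K l
    have f1 : (K j).v i = γ * S.w i := by rw [hKj]; rfl
    have f2 : (K j).w i =
        γ / 2 * S.h i + ((3 - 2 * γ) / 2 * S.U i ^ 2 - P γ dx S i) * S.q i := by rw [hKj]; rfl
    have f3 : (K j).h i = (3 * S.U i ^ 2 - 2 * P γ dx S i) * S.w i := by rw [hKj]; rfl
    rw [f1, f2, f3, hSUj]
    ring
  have e5 := Finset.sum_congr rfl fun j (_ : j ∈ Finset.univ) => e4 j
  rw [Finset.sum_sub_distrib, Finset.sum_sub_distrib, ← Finset.mul_sum,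
    Finset.sum_const_zero] at e5
  unfold energyGap
  rw [hSU]
  linear_combination e1 - Y.U i ^ 2 * e2 - e3 + τ * e5

/-- With `q` and `w` frozen only `q h - q² U²` can change; the product rule is needed for `U²`
alone, and the `Q` terms cancel stage by stage. -/
lemma energyGap_step₂ (hq : rk.PreservesQuadratic) {Y Z : State N}
    (h : rk.IsStep dx ρ (fieldG₂ γ dx) τ Y Z) (i : Cell N) : energyGap Z i = energyGap Y i := by
  obtain ⟨K, hK, -, rfl⟩ := h
  have hv : ∀ j, (K j).v i = 0 := fun j => by rw [hK j]; rfl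
  have hSq : ∀ c : Fin s → ℝ, (Y + τ • ∑ j, c j • K j).q i = Y.q i := fun c => by
    simp only [q_add_smul_sum, hv, mul_zero, Finset.sum_const_zero, add_zero]
  have hSw : ∀ c : Fin s → ℝ, (Y + τ • ∑ j, c j • K j).w i = Y.w i := fun c => by
    refine (add_smul_sum_apply Y τ c K 4 i).trans ?_
    have : ∀ j, K j 4 i = 0 := fun j => by rw [hK j]; rfl
    simp only [this, mul_zero, Finset.sum_const_zero, add_zero]
    rfl
  have hU : ∀ c : Fin s → ℝ, (Y + τ • ∑ j, c j • K j).U i = Y.U i + τ * ∑ j, c j * (K j).U i :=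
    fun c => add_smul_sum_apply Y τ c K 1 i
  have hh : ∀ c : Fin s → ℝ, (Y + τ • ∑ j, c j • K j).h i = Y.h i + τ * ∑ j, c j * (K j).h i :=
    fun c => add_smul_sum_apply Y τ c K 5 i
  have e2 := hq.mul_sub_mul (τ := τ) (Y.U i) (Y.U i) (fun j => (K j).U i) (fun j => (K j).U i)
  simp only [← hU] at e2
  have e4 : ∀ j, Y.q i * (rk.b j * (K j).h i) - Y.q i ^ 2 * (rk.b j *
      ((Y + τ • ∑ l, rk.a j l • K l).U i * (K j).U i +
        (Y + τ • ∑ l, rk.a j l • K l).U i * (K j).U i)) = 0 := fun j => by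
    have hSqj := hSq (rk.a j)
    have hKj := hK j
    set S := Y + τ • ∑ l, rk.a j l • K l
    have f1 : (K j).U i = -Q γ dx S i := by rw [hKj]; rfl
    have f3 : (K j).h i = -2 * Q γ dx S i * S.U i * S.q i := by rw [hKj]; rfl
    rw [f1, f3, hSqj]
    ring
  have e5 := Finset.sum_congr rfl fun j (_ : j ∈ Finset.univ) => e4 j
  rw [Finset.sum_sub_distrib, ← Finset.mul_sum, ← Finset.mul_sum, Finset.sum_const_zero] at e5
  have e6 := hh rk.b
  unfold energyGap
  rw [hSq, hSw]
  linear_combination Y.q i * e6 - Y.q i ^ 2 * e2 + τ * e5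

/-- States satisfying the constraint `(U q)² + w² ≤ q h` with `q + h` positive. -/
def Admissible (Y : State N) : Prop := ∀ i, 0 ≤ energyGap Y i ∧ 0 < Y.q i + Y.h i

lemma Admissible.nonneg {Y : State N} (hY : Admissible Y) (i : Cell N) :
    0 ≤ Y.q i ∧ 0 ≤ Y.h i := by
  obtain ⟨h1, h2⟩ := hY i
  unfold energyGap at h1
  have h3 : 0 ≤ Y.q i * Y.h i := by nlinarith [sq_nonneg (Y.U i * Y.q i), sq_nonneg (Y.w i)]
  rcases mul_nonneg_iff.1 h3 with h | h
  · exact h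
  · linarith [h.1, h.2]

/-- Indeed `w² ≤ q h ≤ (q + h)²`; thus `q + h` controls all of `(q, w, h)`. -/
lemma Admissible.abs_w_le {Y : State N} (hY : Admissible Y) (i : Cell N) :
    |Y.w i| ≤ Y.q i + Y.h i := by
  obtain ⟨h1, h2⟩ := hY i
  obtain ⟨h3, h4⟩ := hY.nonneg i
  unfold energyGap at h1
  refine abs_le_of_sq_le_sq ?_ h2.le
  nlinarith [sq_nonneg (Y.U i * Y.q i), mul_nonneg h3 h4, sq_nonneg (Y.q i), sq_nonneg (Y.h i)]

/-- The local density variables `(v, w, h)` of a state in one cell. -/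
def cellVars (Y : State N) (i : Cell N) : ℝ × ℝ × ℝ := (Y.v i, Y.w i, Y.h i)

/-- The local density variables `(q, w, h)` of a state in one cell. -/
def cellVarsQ (Y : State N) (i : Cell N) : ℝ × ℝ × ℝ := (Y.q i, Y.w i, Y.h i)

lemma cellVarsQ_add_smul_sum (Y : State N) (τ : ℝ) (c : Fin s → ℝ) (K : Fin s → State N)
    (i : Cell N) : cellVarsQ (Y + τ • ∑ j, c j • K j) i =
      cellVarsQ Y i + τ • ∑ j, c j • cellVars (K j) i := by
  have h4 : (Y + τ • ∑ j, c j • K j).w i = Y.w i + τ * ∑ j, c j * (K j).w i :=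
    add_smul_sum_apply Y τ c K 4 i
  have h5 : (Y + τ • ∑ j, c j • K j).h i = Y.h i + τ * ∑ j, c j * (K j).h i :=
    add_smul_sum_apply Y τ c K 5 i
  refine Prod.ext ?_ (Prod.ext ?_ ?_)
  · simpa [cellVarsQ, cellVars, Prod.fst_sum] using q_add_smul_sum Y τ c K i
  · simpa [cellVarsQ, cellVars, Prod.fst_sum, Prod.snd_sum] using h4
  · simpa [cellVarsQ, cellVars, Prod.snd_sum] using h5

/-- A step of a method preserving the energy gap, applied to a vector field whose `(v, w, h)`
components are bounded linearly by `(q, w, h)`, preserves admissibility. -/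
lemma Admissible.step {X : State N → State N} {C : ℝ} (hτ : 0 ≤ τ) (hC : 0 ≤ C)
    (hdx : 0 ≤ dx) (hX : ∀ S, normF dx S ≤ r → ∀ i, ‖cellVars (X S) i‖ ≤ C * ‖cellVarsQ S i‖)
    {Y Z : State N} (hr : normF dx Y + ρ ≤ r) (hsA : C * rk.absA * τ ≤ 1 / 2)
    (hsB : 4 * C * rk.absB * τ < 1) (h : rk.IsStep dx ρ X τ Y Z)
    (hgap : ∀ i, energyGap Z i = energyGap Y i) (hY : Admissible Y) : Admissible Z := by
  intro i
  refine ⟨(hgap i).symm ▸ (hY i).1, ?_⟩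
  obtain ⟨K, hK, hKρ, rfl⟩ := h
  obtain ⟨hq, hh⟩ := hY.nonneg i
  have hpos := (hY i).2
  have hn : ‖cellVarsQ Y i‖ ≤ Y.q i + Y.h i := by
    refine max_le ?_ (max_le (hY.abs_w_le i) ?_)
    · change |Y.q i| ≤ _
      rw [abs_of_nonneg hq]; linarith
    · change |Y.h i| ≤ _
      rw [abs_of_nonneg hh]; linarith
  have hinc := rk.norm_increment_le (Y := cellVarsQ Y i) (K := fun j => cellVars (K j) i) hτ hC
    (fun j => by
      rw [← cellVarsQ_add_smul_sum]
      have := hX _ ((normF_add_le hdx Y (τ • ∑ l, rk.a j l • K l)).trans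
        (le_trans (by linarith [hKρ j]) hr)) i
      rwa [← hK j] at this) hsA
  have e := cellVarsQ_add_smul_sum Y τ rk.b K i
  set d := τ • ∑ j, rk.b j • cellVars (K j) i
  set Z := Y + τ • ∑ j, rk.b j • K j
  have e1 : Z.q i = Y.q i + d.1 := congrArg Prod.fst e
  have e2 : Z.h i = Y.h i + d.2.2 := congrArg (fun p => p.2.2) e
  have d1 : |d.1| ≤ ‖d‖ := norm_fst_le d
  have d2 : |d.2.2| ≤ ‖d‖ := (norm_snd_le d.2).trans (norm_snd_le d)
  have hk : 0 ≤ 2 * C * rk.absB * τ := by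
    have := rk.absB_nonneg
    positivity
  have hd : ‖d‖ ≤ 2 * C * rk.absB * τ * (Y.q i + Y.h i) :=
    hinc.trans (mul_le_mul_of_nonneg_left hn hk)
  rw [e1, e2]
  -- Both `q` and `h` lose at most `2 C b τ (q + h)`, `b` the sum of the `|b_i|`; the total is below
  -- `q + h` by `hsB`.
  nlinarith [neg_abs_le d.1, neg_abs_le d.2.2, mul_lt_mul_of_pos_right hsB hpos]

/-- In each cell the components are linear in `(q, w, h)` with coefficients built from `U`, `P`,
`Q`, which the `F` norm bounds pointwise. -/
lemma exists_cellVars_bound (γ r : ℝ) :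
    ∃ C : ℝ, 0 ≤ C ∧ ∀ (N : ℕ) (dx : ℝ), 0 < dx → ∀ Y : State N, normF dx Y ≤ r → ∀ i,
      ‖cellVars (fieldG₁ γ dx Y) i‖ ≤ C * ‖cellVarsQ Y i‖ ∧
        ‖cellVars (fieldG₂ γ dx Y) i‖ ≤ C * ‖cellVarsQ Y i‖ := by
  have hs := isGridNorm_supNorm
  have hU := lipBdd_U r
  have hUU := hU.mul hs hU
  obtain ⟨C1, hC1, h1⟩ :=
    (hUU.const_smul hs ((3 - 2 * γ) / 2)).add hs ((lipBdd_P hs γ r).const_smul hs (-1))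
  obtain ⟨C2, hC2, h2⟩ := (hUU.const_smul hs 3).add hs ((lipBdd_P hs γ r).const_smul hs (-2))
  obtain ⟨C3, hC3, h3⟩ := ((lipBdd_Q hs γ r).mul hs hU).const_smul hs (-2)
  refine ⟨|γ| + |γ / 2| + C1 + C2 + C3, by positivity, fun N dx hdx Y hY i => ?_⟩
  have a1 := (norm_le_pi_norm _ i).trans (h1 N dx hdx Y hY).1
  have a2 := (norm_le_pi_norm _ i).trans (h2 N dx hdx Y hY).1
  have a3 := (norm_le_pi_norm _ i).trans (h3 N dx hdx Y hY).1
  simp only [Pi.add_apply, Pi.smul_apply, Pi.mul_apply, smul_eq_mul, Real.norm_eq_abs] at a1 a2 a3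
  set m := ‖cellVarsQ Y i‖ with hm
  have hm0 : 0 ≤ m := norm_nonneg _
  have m1 : |Y.q i| ≤ m := norm_fst_le (cellVarsQ Y i)
  have m2 : |Y.w i| ≤ m := (norm_fst_le (cellVarsQ Y i).2).trans (norm_snd_le (cellVarsQ Y i))
  have m3 : |Y.h i| ≤ m := (norm_snd_le (cellVarsQ Y i).2).trans (norm_snd_le (cellVarsQ Y i))
  have hg := abs_nonneg γ
  have hg2 := abs_nonneg (γ / 2)
  have hmul : ∀ {a b c : ℝ}, |a| ≤ c → 0 ≤ c → |b| ≤ m → |a * b| ≤ c * m := fun h1 h2 h3 => by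
    rw [abs_mul]
    exact mul_le_mul h1 h3 (abs_nonneg _) h2
  have hCm : ∀ {c : ℝ}, c ≤ |γ| + |γ / 2| + C1 + C2 + C3 →
      c * m ≤ (|γ| + |γ / 2| + C1 + C2 + C3) * m := fun h => mul_le_mul_of_nonneg_right h hm0
  have hz : |(0 : ℝ)| ≤ (|γ| + |γ / 2| + C1 + C2 + C3) * m := by
    rw [abs_zero]; positivity
  constructor
  · refine max_le ?_ (max_le ?_ ?_)
    · exact (hmul le_rfl hg m2).trans (hCm (by linarith))
    · change |γ / 2 * Y.h i + ((3 - 2 * γ) / 2 * Y.U i ^ 2 - P γ dx Y i) * Y.q i| ≤ _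
      have b1 := hmul le_rfl hg2 m3
      have b2 := hmul a1 hC1 m1
      have e : ((3 - 2 * γ) / 2 * Y.U i ^ 2 - P γ dx Y i) * Y.q i =
        ((3 - 2 * γ) / 2 * (Y.U i * Y.U i) + -1 * P γ dx Y i) * Y.q i := by ring
      rw [e]
      refine (abs_add_le _ _).trans ((add_le_add b1 b2).trans ?_)
      rw [← add_mul]
      exact hCm (by linarith)
    · change |(3 * Y.U i ^ 2 - 2 * P γ dx Y i) * Y.w i| ≤ _
      have e : (3 * Y.U i ^ 2 - 2 * P γ dx Y i) * Y.w i =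
        (3 * (Y.U i * Y.U i) + -2 * P γ dx Y i) * Y.w i := by ring
      rw [e]
      exact (hmul a2 hC2 m2).trans (hCm (by linarith))
  · refine max_le hz (max_le hz ?_)
    change |-2 * Q γ dx Y i * Y.U i * Y.q i| ≤ _
    rw [mul_assoc (-2)]
    exact (hmul a3 hC3 m1).trans (hCm (by linarith))

end Positivity

/-! ### Composition of substeps and well-posedness of the scheme -/

section Scheme

variable {E : Type*} [NormedAddCommGroup E] [NormedSpace ℝ E]

/-- On the ball of radius `R` the relation `Φ` is a function which preserves `A`, moves points by
at most `τ β`, and agrees with an Euler step of size `τ` for `V` up to `D τ²`. -/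
def StepEstimate (A : E → Prop) (R τ : ℝ) (Φ : E → E → Prop) (V : E → E) (β D : ℝ) : Prop :=
  ∀ Y, ‖Y‖ ≤ R → (∃! Z, Φ Y Z) ∧ ∀ Z, Φ Y Z →
    (A Y → A Z) ∧ ‖Z - Y‖ ≤ τ * β ∧ ‖Z - Y - τ • V Y‖ ≤ D * τ ^ 2

variable {A : E → Prop} {R τ : ℝ} {Φ Φ₁ Φ₂ : E → E → Prop} {V V₁ V₂ : E → E}
  {β D β₁ D₁ β₂ D₂ L : ℝ}

lemma StepEstimate.mono (h : StepEstimate A R τ Φ V β D) (hτ : 0 ≤ τ) (hβ : β ≤ β₁)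
    (hD : D ≤ D₁) : StepEstimate A R τ Φ V β₁ D₁ := fun Y hY =>
  ⟨(h Y hY).1, fun Z hZ => ⟨((h Y hY).2 Z hZ).1,
    ((h Y hY).2 Z hZ).2.1.trans (mul_le_mul_of_nonneg_left hβ hτ),
    ((h Y hY).2 Z hZ).2.2.trans (mul_le_mul_of_nonneg_right hD (sq_nonneg _))⟩⟩

/-- The extra error `L * β₁` comes from evaluating `V₂` at the intermediate point instead of `Y`;
that point may lie up to distance 1 outside the ball, hence the radius `R + 1`. -/
lemma StepEstimate.comp (hτ : 0 ≤ τ) (hL : 0 ≤ L) (h₁ : StepEstimate A R τ Φ₁ V₁ β₁ D₁)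
    (h₂ : StepEstimate A (R + 1) τ Φ₂ V₂ β₂ D₂) (hβ : τ * β₁ ≤ 1)
    (hV : ∀ x y, ‖x‖ ≤ R + 1 → ‖y‖ ≤ R + 1 → ‖V₂ x - V₂ y‖ ≤ L * ‖x - y‖) :
    StepEstimate A R τ (Relation.Comp Φ₁ Φ₂) (V₁ + V₂) (β₁ + β₂) (D₁ + D₂ + L * β₁) := by
  intro Y hY
  obtain ⟨⟨W, hW, huW⟩, h1⟩ := h₁ Y hY
  obtain ⟨hA, hWY, hWV⟩ := h1 W hW
  have hWR : ‖W‖ ≤ R + 1 := by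
    have := norm_add_le (W - Y) Y
    rw [sub_add_cancel] at this
    linarith
  obtain ⟨⟨Z, hZ, huZ⟩, h2⟩ := h₂ W hWR
  have huniq : ∀ Z', Relation.Comp Φ₁ Φ₂ Y Z' → Z' = Z := by
    rintro Z' ⟨W', hW', hZ'⟩
    obtain rfl := huW W' hW'
    exact huZ Z' hZ'
  refine ⟨⟨Z, ⟨W, hW, hZ⟩, huniq⟩, fun Z' hZ' => ?_⟩
  obtain rfl := huniq Z' hZ'
  obtain ⟨hA', hZW, hZV⟩ := h2 Z' hZ
  refine ⟨fun h => hA' (hA h), ?_, ?_⟩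
  · have := norm_add_le (Z' - W) (W - Y)
    rw [sub_add_sub_cancel] at this
    linarith
  · have e : Z' - Y - τ • (V₁ + V₂) Y =
        (W - Y - τ • V₁ Y) + ((Z' - W - τ • V₂ W) + τ • (V₂ W - V₂ Y)) := by
      rw [Pi.add_apply, smul_add, smul_sub]
      abel
    have h3 : ‖τ • (V₂ W - V₂ Y)‖ ≤ τ * (L * (τ * β₁)) := by
      rw [norm_smul, Real.norm_of_nonneg hτ]
      exact mul_le_mul_of_nonneg_left ((hV _ _ hWR (by linarith)).trans
        (mul_le_mul_of_nonneg_left hWY hL)) hτ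
    rw [e]
    refine (norm_add_le _ _).trans ((add_le_add_right (norm_add_le _ _) _).trans ?_)
    linarith

/-- A step of size `θ τ` for `X` is read as a step of size `τ` for `θ • X`, so that half steps fit
the same composition rule. -/
lemma RungeKutta.stepEstimate [CompleteSpace E] {s : ℕ} {rk : RungeKutta s}
    (hcons : rk.Consistent) {X : E → E} {B ρ a b θ : ℝ} (ha : rk.absA ≤ a) (hb : rk.absB ≤ b)
    (hτ : 0 ≤ τ) (hB : 0 ≤ B) (hL : 0 ≤ L) (hρ : 0 ≤ ρ) (hθ : 0 ≤ θ) (hθ' : θ ≤ 1)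
    (hXB : ∀ x, ‖x‖ ≤ R + ρ → ‖X x‖ ≤ B)
    (hXL : ∀ x y, ‖x‖ ≤ R + ρ → ‖y‖ ≤ R + ρ → ‖X x - X y‖ ≤ L * ‖x - y‖)
    (hsmall : L * a * τ ≤ 1 / 2) (hsmall' : a * B * τ ≤ ρ)
    (hA : ∀ Y Z, ‖Y‖ ≤ R → rk.NormStep ρ X (θ * τ) Y Z → A Y → A Z) :
    StepEstimate A R τ (rk.NormStep ρ X (θ * τ)) (θ • X) (b * B) (b * L * a * B) := by
  have ha0 := rk.absA_nonneg
  have hb0 := rk.absB_nonneg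
  have hστ : θ * τ ≤ τ := mul_le_of_le_one_left hτ hθ'
  have hσ : 0 ≤ θ * τ := by positivity
  have ha1 : 0 ≤ a := ha0.trans ha
  have hb1 : 0 ≤ b := hb0.trans hb
  have hs : L * rk.absA * (θ * τ) ≤ 1 / 2 := le_trans (by gcongr) hsmall
  have hs' : rk.absA * B * (θ * τ) ≤ ρ := le_trans (by gcongr) hsmall'
  intro Y hY
  have hYρ : ‖Y‖ + ρ ≤ R + ρ := by linarith
  obtain ⟨Z, hZ⟩ := RungeKutta.NormStep.exists hσ hB hL hXB hXL hYρ hs hs'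
  refine ⟨⟨Z, hZ, fun Z' hZ' => hZ'.unique hσ hL hXL hYρ hs hZ⟩,
    fun Z' hZ' => ⟨hA Y Z' hY hZ', ?_, ?_⟩⟩
  · refine (hZ'.norm_sub_le hσ hXB hYρ).trans ?_
    gcongr
  · have := hZ'.norm_sub_sub_le hcons hσ hB hL hρ hXB hXL hYρ
    rw [Pi.smul_apply, smul_smul, mul_comm τ θ]
    refine this.trans ?_
    gcongr

/-- The splitting step in a normed space. -/
def NormSplittingStep {s₁ s₂ : ℕ} (S : Splitting) (rk₁ : RungeKutta s₁) (rk₂ : RungeKutta s₂)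
    (ρ : ℝ) (X₁ X₂ : E → E) (τ : ℝ) (Y Z : E) : Prop :=
  match S with
  | .lieTrotter => ∃ A : E, rk₁.NormStep ρ X₁ τ Y A ∧ rk₂.NormStep ρ X₂ τ A Z
  | .strang => ∃ A B : E,
      rk₁.NormStep ρ X₁ (τ / 2) Y A ∧ rk₂.NormStep ρ X₂ τ A B ∧ rk₁.NormStep ρ X₁ (τ / 2) B Z

lemma stepEstimate_splitting [CompleteSpace E] {s₁ s₂ : ℕ} (S : Splitting) {rk₁ : RungeKutta s₁}
    {rk₂ : RungeKutta s₂} (hcons₁ : rk₁.Consistent) (hcons₂ : rk₂.Consistent) {X₁ X₂ : E → E}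
    {C ρ a b : ℝ} (ha₁ : rk₁.absA ≤ a) (hb₁ : rk₁.absB ≤ b) (ha₂ : rk₂.absA ≤ a)
    (hb₂ : rk₂.absB ≤ b) (hτ : 0 ≤ τ) (hC : 0 ≤ C) (hρ : 0 ≤ ρ)
    (hB₁ : ∀ x, ‖x‖ ≤ R + 1 + ρ → ‖X₁ x‖ ≤ C)
    (hL₁ : ∀ x y, ‖x‖ ≤ R + 1 + ρ → ‖y‖ ≤ R + 1 + ρ → ‖X₁ x - X₁ y‖ ≤ C * ‖x - y‖)
    (hB₂ : ∀ x, ‖x‖ ≤ R + 1 + ρ → ‖X₂ x‖ ≤ C)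
    (hL₂ : ∀ x y, ‖x‖ ≤ R + 1 + ρ → ‖y‖ ≤ R + 1 + ρ → ‖X₂ x - X₂ y‖ ≤ C * ‖x - y‖)
    (hsmall : C * a * τ ≤ 1 / 2) (hsmall' : a * C * τ ≤ ρ) (hsmall'' : 2 * (b * C) * τ ≤ 1)
    (hA₁ : ∀ σ, 0 ≤ σ → σ ≤ τ → ∀ Y Z, ‖Y‖ ≤ R + 1 → rk₁.NormStep ρ X₁ σ Y Z → A Y → A Z)
    (hA₂ : ∀ Y Z, ‖Y‖ ≤ R + 1 → rk₂.NormStep ρ X₂ τ Y Z → A Y → A Z) :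
    StepEstimate A R τ (NormSplittingStep S rk₁ rk₂ ρ X₁ X₂ τ) (X₁ + X₂) (3 * (b * C))
      (3 * (b * C * a * C) + 3 * (C * (b * C))) := by
  have ha : 0 ≤ a := rk₁.absA_nonneg.trans ha₁
  have hb : 0 ≤ b := rk₁.absB_nonneg.trans hb₁
  have hbC : 0 ≤ b * C := by positivity
  have hD : 0 ≤ b * C * a * C := by positivity
  have hCb : 0 ≤ C * (b * C) := by positivity
  have weaken : ∀ {Φ : E → E → Prop} {V : E → E} {β D : ℝ}, StepEstimate A (R + 1) τ Φ V β D →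
      StepEstimate A R τ Φ V β D := fun h Y hY => h Y (by linarith)
  have h1 : ∀ θ : ℝ, 0 ≤ θ → θ ≤ 1 → StepEstimate A (R + 1) τ (rk₁.NormStep ρ X₁ (θ * τ)) (θ • X₁)
      (b * C) (b * C * a * C) := fun θ hθ hθ' =>
    RungeKutta.stepEstimate hcons₁ ha₁ hb₁ hτ hC hC hρ hθ hθ' hB₁ hL₁ hsmall hsmall'
      (hA₁ _ (by positivity) (mul_le_of_le_one_left hτ hθ'))
  have h2 : StepEstimate A (R + 1) τ (rk₂.NormStep ρ X₂ τ) X₂ (b * C) (b * C * a * C) := by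
    have := RungeKutta.stepEstimate (A := A) (R := R + 1) (θ := 1) hcons₂ ha₂ hb₂ hτ hC hC hρ
      zero_le_one le_rfl hB₂ hL₂ hsmall hsmall' (by rw [one_mul]; exact hA₂)
    rwa [one_mul, one_smul] at this
  have hV₂ : ∀ x y, ‖x‖ ≤ R + 1 → ‖y‖ ≤ R + 1 → ‖X₂ x - X₂ y‖ ≤ C * ‖x - y‖ :=
    fun x y hx hy => hL₂ x y (by linarith) (by linarith)
  cases S with
  | lieTrotter =>
    have h3 := h1 1 zero_le_one le_rfl
    rw [one_mul, one_smul] at h3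
    exact ((weaken h3).comp hτ hC h2 (by linarith [mul_nonneg hτ hbC]) hV₂).mono hτ (by linarith)
      (by linarith)
  | strang =>
    have h3 := h1 (1 / 2) (by norm_num) (by norm_num)
    -- This composition fixes the constants: three substep errors, plus `C` times the displacements
    -- `b C` and `2 b C` before the second and third substeps.
    have h4 := ((weaken h3).comp hτ hC h2 (by linarith [mul_nonneg hτ hbC]) hV₂).comp hτ hC h3
      (by linarith) (fun x y hx hy => by
        rw [Pi.smul_apply, Pi.smul_apply, ← smul_sub, norm_smul]
        have := hL₁ x y (by linarith) (by linarith)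
        have h0 : ‖(1 / 2 : ℝ)‖ = 1 / 2 := by norm_num
        rw [h0]
        linarith [norm_nonneg (X₁ x - X₁ y)])
    have e1 : (1 / 2 : ℝ) • X₁ + X₂ + (1 / 2 : ℝ) • X₁ = X₁ + X₂ := by
      rw [add_right_comm, ← add_smul]
      norm_num
    have e2 : Relation.Comp (Relation.Comp (rk₁.NormStep ρ X₁ (1 / 2 * τ)) (rk₂.NormStep ρ X₂ τ))
        (rk₁.NormStep ρ X₁ (1 / 2 * τ)) = NormSplittingStep .strang rk₁ rk₂ ρ X₁ X₂ τ := by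
      rw [one_div_mul_eq_div]
      ext Y Z
      constructor
      · rintro ⟨W, ⟨W', h, h'⟩, h''⟩
        exact ⟨W', W, h, h', h''⟩
      · rintro ⟨W', W, h, h', h''⟩
        exact ⟨W, ⟨W', h, h'⟩, h''⟩
    rw [e1, e2] at h4
    exact h4.mono hτ (by linarith) (by linarith)

/-- Well-posedness of a scheme along a bounded trajectory, with invariance of `A`. -/
lemma StepEstimate.exists_unique_sequence {X : E → E} {φ : ℝ → E} {r B T : ℝ} {J : ℕ}
    (h : StepEstimate A (r + 1) τ Φ X β D)
    (hτ : 0 ≤ τ) (hB : 0 ≤ B) (hL : 0 ≤ L) (hD : 0 ≤ D)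
    (hXB : ∀ x, ‖x‖ ≤ r + 1 → ‖X x‖ ≤ B)
    (hXL : ∀ x y, ‖x‖ ≤ r + 1 → ‖y‖ ≤ r + 1 → ‖X x - X y‖ ≤ L * ‖x - y‖)
    (hφ : ∀ t ∈ Set.Icc (0 : ℝ) T, HasDerivWithinAt φ (X (φ t)) (Set.Icc 0 T) t)
    (hφr : ∀ t ∈ Set.Icc (0 : ℝ) T, ‖φ t‖ ≤ r)
    (hsmall : (D + L * B) * T * Real.exp (L * T) * τ ≤ 1) (hJ : J * τ ≤ T) (hA : A (φ 0)) :
    ∃ Y : ℕ → E, (Y 0 = φ 0 ∧ ∀ j < J, Φ (Y j) (Y (j + 1))) ∧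
      (∀ Y' : ℕ → E, (Y' 0 = φ 0 ∧ ∀ j < J, Φ (Y' j) (Y' (j + 1))) → ∀ j ≤ J, Y' j = Y j) ∧
      ∀ j ≤ J, A (Y j) := by
  classical
  -- Stated for arbitrary sequences of any length `m ≤ J`, so that a partially built sequence is
  -- already known to stay in the ball.
  have hbound : ∀ m ≤ J, ∀ Y : ℕ → E, Y 0 = φ 0 → (∀ j < m, Φ (Y j) (Y (j + 1))) →
      ∀ j ≤ m, ‖Y j‖ ≤ r + 1 := by
    intro m hm Y h0 hY j hj
    have hmT : (m : ℝ) * τ ≤ T :=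
      (mul_le_mul_of_nonneg_right (by exact_mod_cast hm) hτ).trans hJ
    have hjT : (j : ℝ) * τ ≤ T :=
      (mul_le_mul_of_nonneg_right (by exact_mod_cast hj) hτ).trans hmT
    have h1 := norm_sub_le_one_of_step hτ hB hL hD hXB hXL hφ hφr
      (fun Y Z hY hZ => ((h Y hY).2 Z hZ).2.2) hsmall hmT h0 hY j hj
    have h2 := norm_add_le (Y j - φ (j * τ)) (φ (j * τ))
    rw [sub_add_cancel] at h2
    linarith [hφr (j * τ) ⟨by positivity, hjT⟩]
  let F : E → E := fun y => if h : ∃ z, Φ y z then h.choose else y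
  have hF : ∀ y, (∃ z, Φ y z) → Φ y (F y) := fun y hy => by
    simp only [F, dif_pos hy]
    exact hy.choose_spec
  let Y : ℕ → E := fun j => F^[j] (φ 0)
  have hsucc : ∀ j, Y (j + 1) = F (Y j) := fun j => Function.iterate_succ_apply' F j _
  have hstep : ∀ m ≤ J, ∀ j < m, Φ (Y j) (Y (j + 1)) := by
    intro m
    induction m with
    | zero => intro _ j hj; omega
    | succ m ih =>
      intro hm j hj
      rcases Nat.lt_succ_iff_lt_or_eq.1 hj with hj | rfl
      · exact ih (by omega) j hj
      · rw [hsucc]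
        exact hF _ (h _ (hbound j (by omega) Y rfl (ih (by omega)) j le_rfl)).1.exists
  have hYr := hbound J le_rfl Y rfl (hstep J le_rfl)
  refine ⟨Y, ⟨rfl, hstep J le_rfl⟩, fun Y' hY' j => ?_, fun j => ?_⟩
  · induction j with
    | zero => intro _; exact hY'.1
    | succ j ih =>
      intro hj
      have h1 := hY'.2 j (by omega)
      rw [ih (by omega)] at h1
      exact (h _ (hYr j (by omega))).1.unique h1 (hstep J le_rfl j (by omega))
  · induction j with
    | zero => intro _; exact hA
    | succ j ih =>
      intro hj
      exact ((h _ (hYr j (by omega))).2 _ (hstep J le_rfl j (by omega))).1 (ih (by omega))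

end Scheme

/-- The norm of `FState` is `normF` by definition, so the abstract scheme is the concrete one. -/
lemma isSplittingStep_iff {s₁ s₂ N : ℕ} {dx : ℝ} [Fact (0 < dx)] (S : Splitting)
    (rk₁ : RungeKutta s₁) (rk₂ : RungeKutta s₂) (γ ρ τ : ℝ) (Y Z : State N) :
    IsSplittingStep S rk₁ rk₂ γ dx ρ τ Y Z ↔ NormSplittingStep (E := FState N dx) S rk₁ rk₂ ρ
      (fieldG₁ (N := N) γ dx) (fieldG₂ (N := N) γ dx) τ Y Z := by
  cases S <;> exact Iff.rfl

end HyperelasticRod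

theorem mainTheorem3 (γ : ℝ) (S : HyperelasticRod.Splitting)
    {s₁ s₂ : ℕ} (rk₁ : HyperelasticRod.RungeKutta s₁) (rk₂ : HyperelasticRod.RungeKutta s₂)
    (hcons₁ : rk₁.Consistent) (hcons₂ : rk₂.Consistent)
    (hquad₁ : rk₁.PreservesQuadratic) (hquad₂ : rk₂.PreservesQuadratic)
    (ρ : ℝ) (hρ : 0 < ρ) (c : ℝ) (hc : 0 < c) (T : ℝ) (hT : 0 < T) (M₀ M : ℝ) :
    ∃ n : ℝ, 0 < n ∧
      ∀ (dx : ℝ) (N NT : ℕ), 0 < dx → 0 < N → 0 < NT →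
        dx + 1 / ((N : ℝ) * dx) + T / (NT : ℝ) < 1 / n →
        ∀ Y₀ : HyperelasticRod.State N,
          HyperelasticRod.normFInf dx Y₀ ≤ M₀ →
          (∀ i, (Y₀.U i * Y₀.q i) ^ 2 + Y₀.w i ^ 2 ≤ Y₀.q i * Y₀.h i ∧
            0 ≤ Y₀.q i ∧ 0 ≤ Y₀.h i ∧ c ≤ Y₀.q i + Y₀.h i) →
          (∃ φ : ℝ → HyperelasticRod.State N,
            HyperelasticRod.IsSemidiscreteSolution γ dx T Y₀ φ ∧
              ∀ t ∈ Set.Icc (0 : ℝ) T, HyperelasticRod.normF dx (φ t) ≤ M) →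
          ∃ Y : ℕ → HyperelasticRod.State N,
            HyperelasticRod.IsNumericalSolution S rk₁ rk₂ γ dx ρ (T / NT) NT Y₀ Y ∧
            (∀ Y' : ℕ → HyperelasticRod.State N,
              HyperelasticRod.IsNumericalSolution S rk₁ rk₂ γ dx ρ (T / NT) NT Y₀ Y' →
                ∀ j ≤ NT, Y' j = Y j) ∧
            ∀ j, 1 ≤ j → j ≤ NT → ∀ i, 0 ≤ (Y j).q i ∧ 0 ≤ (Y j).h i := by
  open HyperelasticRod in
  -- The radius leaves 1 for the distance to `φ`, 1 for the intermediate points of a splitting step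
  -- and `ρ` for the internal stages.
  obtain ⟨C₁, hC₁, hX₁⟩ := fieldG₁_bound γ (M + 1 + 1 + ρ)
  obtain ⟨C₂, hC₂, hX₂⟩ := fieldG₂_bound γ (M + 1 + 1 + ρ)
  obtain ⟨C₃, hC₃, hX₃⟩ := exists_cellVars_bound γ (M + 1 + 1 + ρ)
  have ha₁ := rk₁.absA_nonneg
  have ha₂ := rk₂.absA_nonneg
  have hb₁ := rk₁.absB_nonneg
  have hb₂ := rk₂.absB_nonneg
  set C := C₁ + C₂ with hCdef
  have hC : 0 ≤ C := by positivity
  set a := rk₁.absA + rk₂.absA with hadef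
  set b := rk₁.absB + rk₂.absB with hbdef
  have ha : 0 ≤ a := by positivity
  have hb : 0 ≤ b := by positivity
  set D := 3 * (b * C * a * C) + 3 * (C * (b * C)) with hDdef
  have hD : 0 ≤ D := by positivity
  -- The Gronwall constant, with `2 * C` as both bound and Lipschitz constant of `G₁ + G₂`.
  set κ := (D + 2 * C * (2 * C)) * T * Real.exp (2 * C * T) with hκ
  have hκ0 : 0 ≤ κ := by positivity
  -- One summand for each smallness condition on `τ`; the 1 makes `n` positive.
  set n := 1 + 2 * (C * a) + a * C / ρ + 2 * (b * C) + 2 * (C₃ * a) + 4 * (C₃ * b) + κ with hn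
  have hn0 : 0 < n := by positivity
  refine ⟨n, hn0, ?_⟩
  intro dx N NT hdx hN hNT hlt Y₀ _ hY₀ ⟨φ, ⟨hφ0, hφ⟩, hφM⟩
  have : Fact (0 < dx) := ⟨hdx⟩
  have hNT' : (0 : ℝ) < NT := by exact_mod_cast hNT
  set τ := T / (NT : ℝ) with hτdef
  have hτ0 : 0 < τ := by positivity
  have hτn : n * τ < 1 := by
    have hN' : (0 : ℝ) < N := by exact_mod_cast hN
    have : 0 < 1 / ((N : ℝ) * dx) := by positivity
    rw [mul_comm, ← lt_div_iff₀ hn0]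
    linarith
  have small : ∀ k : ℝ, k ≤ n → k * τ ≤ 1 := fun k hk =>
    (mul_le_mul_of_nonneg_right hk hτ0.le).trans hτn.le
  have hCa : 0 ≤ C * a := by positivity
  have haCρ : 0 ≤ a * C / ρ := by positivity
  have hbC : 0 ≤ b * C := by positivity
  have hC₃a : 0 ≤ C₃ * a := by positivity
  have hC₃b : 0 ≤ C₃ * b := by positivity
  have hs1 : C * a * τ ≤ 1 / 2 := by linarith [small (2 * (C * a)) (by linarith)]
  have hs2 : a * C * τ ≤ ρ := by
    have h := small (a * C / ρ) (by linarith)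
    rw [div_mul_eq_mul_div, div_le_one hρ] at h
    exact h
  have hs3 : 2 * (b * C) * τ ≤ 1 := small _ (by linarith)
  have hs4 : C₃ * a * τ ≤ 1 / 2 := by linarith [small (2 * (C₃ * a)) (by linarith)]
  have hs5 : 4 * (C₃ * b) * τ < 1 :=
    (mul_le_mul_of_nonneg_right (by linarith) hτ0.le).trans_lt hτn
  have hs6 : κ * τ ≤ 1 := small _ (by linarith)
  have hCle₁ : C₁ ≤ C := by linarith
  have hCle₂ : C₂ ≤ C := by linarith
  let X₁ : FState N dx → FState N dx := fieldG₁ (N := N) γ dx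
  let X₂ : FState N dx → FState N dx := fieldG₂ (N := N) γ dx
  have hB₁ : ∀ x : FState N dx, ‖x‖ ≤ M + 1 + 1 + ρ → ‖X₁ x‖ ≤ C :=
    fun x hx => (hX₁ N dx hdx x hx).1.trans hCle₁
  have hL₁ : ∀ x y : FState N dx, ‖x‖ ≤ M + 1 + 1 + ρ → ‖y‖ ≤ M + 1 + 1 + ρ →
      ‖X₁ x - X₁ y‖ ≤ C * ‖x - y‖ := fun x y hx hy =>
    ((hX₁ N dx hdx x hx).2 y hy).trans (mul_le_mul_of_nonneg_right hCle₁ (norm_nonneg (x - y)))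
  have hB₂ : ∀ x : FState N dx, ‖x‖ ≤ M + 1 + 1 + ρ → ‖X₂ x‖ ≤ C :=
    fun x hx => (hX₂ N dx hdx x hx).1.trans hCle₂
  have hL₂ : ∀ x y : FState N dx, ‖x‖ ≤ M + 1 + 1 + ρ → ‖y‖ ≤ M + 1 + 1 + ρ →
      ‖X₂ x - X₂ y‖ ≤ C * ‖x - y‖ := fun x y hx hy =>
    ((hX₂ N dx hdx x hx).2 y hy).trans (mul_le_mul_of_nonneg_right hCle₂ (norm_nonneg (x - y)))
  have hA₁ : ∀ σ, 0 ≤ σ → σ ≤ τ → ∀ Y Z : FState N dx, ‖Y‖ ≤ M + 1 + 1 →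
      rk₁.NormStep ρ X₁ σ Y Z → Admissible (N := N) Y → Admissible (N := N) Z := by
    intro σ hσ hστ Y Z hY hZ hAY
    refine Admissible.step (rk := rk₁) (X := fieldG₁ γ dx) (dx := dx) (ρ := ρ)
      (r := M + 1 + 1 + ρ) hσ hC₃ hdx.le (fun S hS i => (hX₃ N dx hdx S hS i).1)
      (add_le_add_left hY ρ) (le_trans ?_ hs4) (lt_of_le_of_lt ?_ hs5) hZ
      (energyGap_step₁ hquad₁ hZ) hAY
    · gcongr
      linarith
    · rw [mul_assoc 4]
      gcongr
      linarith
  have hA₂ : ∀ Y Z : FState N dx, ‖Y‖ ≤ M + 1 + 1 →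
      rk₂.NormStep ρ X₂ τ Y Z → Admissible (N := N) Y → Admissible (N := N) Z := by
    intro Y Z hY hZ hAY
    refine Admissible.step (rk := rk₂) (X := fieldG₂ γ dx) (dx := dx) (ρ := ρ)
      (r := M + 1 + 1 + ρ) hτ0.le hC₃ hdx.le (fun S hS i => (hX₃ N dx hdx S hS i).2)
      (add_le_add_left hY ρ) (le_trans ?_ hs4) (lt_of_le_of_lt ?_ hs5) hZ
      (energyGap_step₂ hquad₂ hZ) hAY
    · gcongr
      linarith
    · rw [mul_assoc 4]
      gcongr
      linarith
  have hest := stepEstimate_splitting S hcons₁ hcons₂ (a := a) (b := b) (by linarith)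
    (by linarith) (by linarith) (by linarith) hτ0.le hC hρ.le hB₁ hL₁ hB₂ hL₂ hs1 hs2 hs3 hA₁ hA₂
  -- The derivative is given in the maximum norm; the continuous linear identity transports it to
  -- the norm of `F`.
  have hφ' : ∀ t ∈ Set.Icc (0 : ℝ) T, HasDerivWithinAt
      (fun t => FState.ofState (dx := dx) (φ t)) ((X₁ + X₂) (FState.ofState (φ t)))
      (Set.Icc 0 T) t := fun t ht => by
    have h1 := (FState.ofState (N := N) (dx := dx)).hasFDerivAt.comp_hasDerivWithinAt t (hφ t ht)
    rw [fieldG_eq] at h1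
    exact h1
  have hA0 : Admissible (N := N) (FState.ofState (dx := dx) (φ 0)) := by
    rw [hφ0]
    intro i
    obtain ⟨h1, -, -, h2⟩ := hY₀ i
    refine ⟨?_, lt_of_lt_of_le hc h2⟩
    change 0 ≤ Y₀.q i * Y₀.h i - (Y₀.U i * Y₀.q i) ^ 2 - Y₀.w i ^ 2
    linarith
  obtain ⟨Y, hY, huniq, hAY⟩ := hest.exists_unique_sequence (J := NT) (B := 2 * C) (L := 2 * C)
    (T := T) hτ0.le (by positivity) (by positivity) hD
    (fun x hx => (norm_add_le _ _).trans
      (by linarith [hB₁ x (by linarith), hB₂ x (by linarith)]))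
    (fun x y hx hy => by
      rw [Pi.add_apply, Pi.add_apply, add_sub_add_comm]
      refine (norm_add_le _ _).trans ?_
      linarith [hL₁ x y (by linarith) (by linarith), hL₂ x y (by linarith) (by linarith)])
    hφ' hφM hs6 (by rw [hτdef, mul_div_cancel₀ _ hNT'.ne']) hA0
  have hiff : ∀ Y : ℕ → State N, IsNumericalSolution S rk₁ rk₂ γ dx ρ τ NT Y₀ Y ↔
      (Y 0 = φ 0 ∧ ∀ j < NT, NormSplittingStep (E := FState N dx) S rk₁ rk₂ ρ X₁ X₂ τ
        (Y j) (Y (j + 1))) := fun Y => by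
    unfold IsNumericalSolution
    rw [hφ0]
    simp only [isSplittingStep_iff]
    rfl
  exact ⟨Y, (hiff Y).2 hY, fun Y' hY' => huniq Y' ((hiff Y').1 hY'),
    fun j _ hj i => Admissible.nonneg (hAY j hj) i⟩
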